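/- Let $\varepsilon\in(0,1)$, $\varrho>1$, $s\ge 1$, $\zeta>0$ be real numbers, let $\Delta>1$ be an integer, and let $\beta,\gamma,\lambda\in\mathbb R$ satisfy $0\le\beta\le\gamma$, $\gamma>0$, $\lambda>0$. Let $G=(V,E)$ be a finite connected simple graph of maximum degree $\Delta$ whose adjacency matrix $A_G$ satisfies $\|A_G\|_2=\varrho$, and let $\mu$ be the Gibbs distribution on $\{\pm1\}^V$ in which $\mu(\sigma)$ is proportional to $\lambda^{\#\{v:\sigma(v)=+1\}}\,\beta^{\#\{\text{edges with both ends }+1\}}\,\gamma^{\#\{\text{edges with both ends }-1\}}$. For $\Lambda\subseteq V$ and $\tau\in\{\pm1\}^\Lambda$ let $\mathcal I^{\Lambda,\tau}_G$ be the influence matrix, indexed by $V\setminus\Lambda$, with entries $$\mathcal I^{\Lambda,\tau}_G(w,u)=\mu_u(+1\mid(\Lambda,\tau),(w,+1))-\mu_u(+1\mid(\Lambda,\tau),(w,-1)),$$ where the entry is $0$ if the spin of $w$ or of $u$ is forced by the pinning $(\Lambda,\tau)$. For $d\ge1$ and $y\in\mathbb R^d$ put $$H_d(y)=\log\lambda+\sum_{i=1}^d\log\frac{\beta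 e^{y_i}+1}{e^{y_i}+\gamma},\qquad h(x)=-\frac{(1-\beta\gamma)e^x}{(\beta e^x+1)(e^x+\gamma)} ,$$ and let $J=\bigcup_{1\le d<\Delta}J_d\subseteq\mathbb R$, where $J_d$ is the closed interval with end points $\log(\lambda\beta^d)$ and $\log(\lambda/\gamma^d)$ (with $\log 0=-\infty$, not included). A differentiable, strictly increasing function $\Psi:\mathbb R\to\mathbb R$ with derivative $\chi=\Psi'>0$ is an $(s,\delta,c)$-potential with respect to $(\beta,\gamma,\lambda)$ if (Contraction) for all $1\le d<\Delta$, $y\in\mathbb R^d$ and $m\in\mathbb R^d_{\ge0}$: $\ \chi(H_d(y))\sum_{j=1}^d\frac{|h(y_j)|}{\chi(y_j)}m_j\le\delta^{1/s}\|m\|_s$; (Boundedness) for all $z,x\in J$: $\ \chi(z)\,\frac{|h(x)|}{\chi(x)}\le c$. Suppose that $\Psi$ is an $(s,\delta,c)$-potential with respect to $(\beta,\gamma,\lambda)$ for $\delta=\frac{1-\varepsilon}{\varrho}$ and $c=\frac{\zeta}{\varrho}$. If $G$ has a vertex of degree $1$, suppose also that the boundedness inequality holds for all $z,x\in J\cup\{\log\lambda\}$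 (this is automatic when $\log\lambda\in J$, for instance for the hard-core and the Ising model). Then for every $\Lambda\subseteq V$ and every $\tau\in\{\pm1\}^\Lambda$ the spectral radius of the influence matrix satisfies $$\rho\bigl(\mathcal I^{\Lambda,\tau}_G\bigr)\le 1+\zeta\,\bigl(1-(1-\varepsilon)^{1/s}\bigr)^{-1}\Bigl(\frac{\Delta}{\varrho}\Bigr)^{1-1/s}.$$ -/

import Mathlib

open scoped BigOperators

namespace TwoSpin

noncomputable section

open Classical in
/-- Unnormalised weight of a configuration `σ` of the 2-spin system with parameters `(β, γ, lam)`
on the graph `G`.  The spin `+1` is `true`, the spin `-1` is `false`. -/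
def weight {V : Type*} [Fintype V] (G : SimpleGraph V) (β γ lam : ℝ) (σ : V → Bool) : ℝ :=
  lam ^ (Finset.univ.filter fun v : V => σ v = true).card *
    β ^ (G.edgeFinset.filter fun e => ∀ v ∈ e, σ v = true).card *
    γ ^ (G.edgeFinset.filter fun e => ∀ v ∈ e, σ v = false).card

open Classical in
/-- The partition function. -/
def partitionFunction {V : Type*} [Fintype V] (G : SimpleGraph V) (β γ lam : ℝ) : ℝ :=
  ∑ σ : V → Bool, weight G β γ lam σ

/-- The Gibbs distribution `μ` (its probability mass function). -/
def gibbs {V : Type*} [Fintype V] (G : SimpleGraph V) (β γ lam : ℝ) (σ : V → Bool) : ℝ :=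
  weight G β γ lam σ / partitionFunction G β γ lam

open Classical in
/-- The probability under `μ` of an event. -/
def gibbsProb {V : Type*} [Fintype V] (G : SimpleGraph V) (β γ lam : ℝ)
    (A : Set (V → Bool)) : ℝ :=
  ∑ σ : V → Bool, if σ ∈ A then gibbs G β γ lam σ else 0

/-- The event that the configuration at `Λ` is `τ`. -/
def pinEvent {V : Type*} (Λ : Finset V) (τ : {v // v ∈ Λ} → Bool) : Set (V → Bool) :=
  {σ | ∀ v : {v // v ∈ Λ}, σ v.1 = τ v}

/-- The event that the configuration at `v` is `x`. -/
def spinEvent {V : Type*} (v : V) (x : Bool) : Set (V → Bool) :=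
  {σ | σ v = x}

/-- `μ_u(+1 | (Λ, τ), (w, x))`, for a conditioning event of positive probability. -/
def condMarginal {V : Type*} [Fintype V] (G : SimpleGraph V) (β γ lam : ℝ)
    (Λ : Finset V) (τ : {v // v ∈ Λ} → Bool) (w : V) (x : Bool) (u : V) : ℝ :=
  gibbsProb G β γ lam (pinEvent Λ τ ∩ spinEvent w x ∩ spinEvent u true) /
    gibbsProb G β γ lam (pinEvent Λ τ ∩ spinEvent w x)

/-- Both spins are possible at `v` under the pinning `(Λ, τ)`, i.e. the conditional marginal
`μ_v(+1 | Λ, τ)` is not in `{0, 1}`. -/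
def IsFree {V : Type*} [Fintype V] (G : SimpleGraph V) (β γ lam : ℝ)
    (Λ : Finset V) (τ : {v // v ∈ Λ} → Bool) (v : V) : Prop :=
  ∀ x : Bool, 0 < gibbsProb G β γ lam (pinEvent Λ τ ∩ spinEvent v x)

open Classical in
/-- The pairwise influence matrix, indexed by the vertices outside `Λ`.  An entry is `0` when
the spin of one of the two vertices is forced by the pinning. -/
def influenceMatrix {V : Type*} [Fintype V] (G : SimpleGraph V) (β γ lam : ℝ)
    (Λ : Finset V) (τ : {v // v ∈ Λ} → Bool) : Matrix {v // v ∉ Λ} {v // v ∉ Λ} ℝ :=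
  Matrix.of fun w u =>
    if IsFree G β γ lam Λ τ w.1 ∧ IsFree G β γ lam Λ τ u.1 then
      condMarginal G β γ lam Λ τ w.1 true u.1 - condMarginal G β γ lam Λ τ w.1 false u.1
    else 0

/-- The tree recursion `H_d` for log-ratios of marginals. -/
def logRecursion (β γ lam : ℝ) {d : ℕ} (y : Fin d → ℝ) : ℝ :=
  Real.log lam + ∑ i, Real.log ((β * Real.exp (y i) + 1) / (Real.exp (y i) + γ))

/-- The function `h`, the partial derivative of `H_d` in any coordinate. -/
def recursionDeriv (β γ x : ℝ) : ℝ :=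
  -(((1 - β * γ) * Real.exp x) / ((β * Real.exp x + 1) * (Real.exp x + γ)))

open Classical in
/-- The real interval `J_d` with end points `log (lam * β ^ d)` and `log (lam / γ ^ d)`, written
through `exp` so that for `β = 0` the lower end point is `-∞`. -/
def logRatioInterval (β γ lam : ℝ) (d : ℕ) : Set ℝ :=
  if β * γ < 1 then
    {x | lam * β ^ d ≤ Real.exp x ∧ Real.exp x ≤ lam / γ ^ d}
  else
    {x | lam / γ ^ d ≤ Real.exp x ∧ Real.exp x ≤ lam * β ^ d}

/-- The set `J`, the union of the `J_d` over `1 ≤ d < Δ`. -/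
def logRatioRange (β γ lam : ℝ) (Δ : ℕ) : Set ℝ :=
  {x | ∃ d : ℕ, 1 ≤ d ∧ d < Δ ∧ x ∈ logRatioInterval β γ lam d}

/-- The boundedness inequality on a set `S` of log-ratios: with `χ = Ψ'`,
`χ(z) * |h(x)| / χ(x) ≤ c` for all `z, x ∈ S`. -/
def BoundedOn (β γ c : ℝ) (Ψ : ℝ → ℝ) (S : Set ℝ) : Prop :=
  ∀ z ∈ S, ∀ x ∈ S, deriv Ψ z * (|recursionDeriv β γ x| / deriv Ψ x) ≤ c

/-- `Ψ` is an `(s, δ, c)`-potential with respect to `(β, γ, lam)` and the degree bound `Δ`.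
Positivity of `χ = Ψ'` makes the quotients by `χ` meaningful.  Since `Ψ` is injective, the
points `y j = Ψ⁻¹(ŷ j)`, with `ŷ j` in the image of `Ψ`, are exactly the real numbers. -/
structure IsPotential (s δ c : ℝ) (Δ : ℕ) (β γ lam : ℝ) (Ψ : ℝ → ℝ) : Prop where
  differentiable : Differentiable ℝ Ψ
  strictMono : StrictMono Ψ
  deriv_pos : ∀ y, 0 < deriv Ψ y
  contraction : ∀ d : ℕ, 1 ≤ d → d < Δ → ∀ y m : Fin d → ℝ, (∀ j, 0 ≤ m j) →
    deriv Ψ (logRecursion β γ lam y) *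
        ∑ j, |recursionDeriv β γ (y j)| / deriv Ψ (y j) * m j
      ≤ δ ^ (1 / s) * (∑ j, m j ^ s) ^ (1 / s)
  boundedness : BoundedOn β γ c Ψ (logRatioRange β γ lam Δ)

end

end TwoSpin

/-! Let `f > 0` be a Perron vector of the adjacency matrix and `x = f ^ (1/s)`
(`exists_pos_adjMatrix_le`). In the sup norm weighted by `x`, the spectral radius is bounded by
weighted row sums (`spectralRadius_map_ofReal_le`), so it is enough to bound `T w = ∑ u, |I(w,u)| x
u` by the claimed constant times `x w`.

Influences satisfy the recursion of the self-avoiding-walk tree, but no tree is built: a subsystem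
is a vertex set `S` with counts `a`, `b` of neighbours pinned to `+1` and `-1`. Replace `w` by one
pinned copy per neighbour and flip the copies one at a time (`exists_flip`). Each flip contributes
one factor of the ratio recursion, and changes a marginal by `h` times an influence in a smaller
system.

Every vertex below the root has one unrecorded neighbour, its parent, so its recursion has fewer
than `Δ` arguments and contraction applies. If `χ(log R i) T i ≤ C M x i` for the children, where `χ
≤ M` on `J`, then contraction and `∑ x u ^ s ≤ ϱ x w ^ s` over the neighbours give `χ(log R w) T w ≤
(1 + κ C) M x w` with `κ = (1-ε)^(1/s)`. The choice `C = (1-κ)⁻¹` closes the induction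
(`deriv_mul_totalInfluence_le`). At the root, which may have `Δ` children, boundedness and the power
mean inequality take the place of contraction (`totalInfluence_le`).

Pinned neighbours have log-ratio `±∞`. They are reached as limits of the contraction inequality,
although `χ` need not be continuous (`IsPotential.contraction_limit`). -/

namespace TwoSpin

/-! ### Systems with boundary counts, and the effect of flipping pinned neighbours -/

section Model

variable {V : Type*} [Fintype V] [DecidableEq V]

open Classical in
/-- The number of edges of `G` with both ends in `T`. -/
noncomputable def internalEdges (G : SimpleGraph V) (T : Finset V) : ℕ :=
  (G.edgeFinset.filter fun e => ∀ v ∈ e, v ∈ T).card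

/-- The indicator function of a finite set of vertices. -/
def ind (N : Finset V) : V → ℕ := fun u => if u ∈ N then 1 else 0

omit [Fintype V] in
theorem ind_of_mem {N : Finset V} {u : V} (h : u ∈ N) : ind N u = 1 := by simp [ind, h]

omit [Fintype V] in
theorem ind_of_notMem {N : Finset V} {u : V} (h : u ∉ N) : ind N u = 0 := by simp [ind, h]

variable (G : SimpleGraph V) [DecidableRel G.Adj] (β γ lam : ℝ)

/-- The weight of the configuration on `S` with set of `+1` spins `T`, when the vertex `v` has
in addition `a v` neighbours pinned to `+1` and `b v` neighbours pinned to `-1`. -/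
noncomputable def fieldWeight (S : Finset V) (a b : V → ℕ) (T : Finset V) : ℝ :=
  (∏ v ∈ T, lam * β ^ a v) * (∏ v ∈ S \ T, γ ^ b v) * β ^ internalEdges G T *
    γ ^ internalEdges G (S \ T)

/-- The partition function of the system on `S` with boundary counts `a` and `b`. -/
noncomputable def fieldZ (S : Finset V) (a b : V → ℕ) : ℝ :=
  ∑ T ∈ S.powerset, fieldWeight G β γ lam S a b T

/-- The total weight of the configurations on `S` with spin `+1` at `u`. -/
noncomputable def fieldZAt (S : Finset V) (a b : V → ℕ) (u : V) : ℝ :=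
  ∑ T ∈ S.powerset, if u ∈ T then fieldWeight G β γ lam S a b T else 0

/-- The probability of the spin `+1` at `u` in the system on `S`. -/
noncomputable def fieldMarginal (S : Finset V) (a b : V → ℕ) (u : V) : ℝ :=
  fieldZAt G β γ lam S a b u / fieldZ G β γ lam S a b

/-- The ratio of the probabilities of the spins `+1` and `-1` at `w` in the system on
`insert w S`, for `w ∉ S`. -/
noncomputable def fieldRatio (S : Finset V) (a b : V → ℕ) (w : V) : ℝ :=
  (lam * β ^ a w * fieldZ G β γ lam S (a + ind (G.neighborFinset w)) b) /
    (γ ^ b w * fieldZ G β γ lam S a (b + ind (G.neighborFinset w)))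

/-- The influence of `w` on `u` in the system on `insert w S`, for `w ∉ S`. -/
noncomputable def fieldInfluence (S : Finset V) (a b : V → ℕ) (w u : V) : ℝ :=
  if u = w then 1 else
    fieldMarginal G β γ lam S (a + ind (G.neighborFinset w)) b u -
      fieldMarginal G β γ lam S a (b + ind (G.neighborFinset w)) u

/-- `recursionDeriv` as a function of the ratio instead of its logarithm. -/
noncomputable def ratioDeriv (r : ℝ) : ℝ :=
  -(((1 - β * γ) * r) / ((β * r + 1) * (r + γ)))

theorem internalEdges_insert {w : V} {T : Finset V} (hw : w ∉ T) :
    internalEdges G (insert w T) = internalEdges G T + ∑ v ∈ T, ind (G.neighborFinset w) v := by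
  classical
  have hsum : ∑ v ∈ T, ind (G.neighborFinset w) v = (T.filter fun v => G.Adj w v).card := by
    simp only [ind, SimpleGraph.mem_neighborFinset, Finset.card_filter]
  have himg : ((T.filter fun v => G.Adj w v).image fun v => s(w, v)).card =
      (T.filter fun v => G.Adj w v).card := by
    apply Finset.card_image_of_injective
    intro x y h
    exact Sym2.congr_right.1 h
  rw [hsum, ← himg]
  unfold internalEdges
  rw [← Finset.card_union_of_disjoint]
  · congr 1
    ext e
    induction e with
    | _ x y =>
      simp only [Finset.mem_filter, SimpleGraph.mem_edgeFinset, SimpleGraph.mem_edgeSet,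
        Sym2.mem_iff, Finset.mem_insert, Finset.mem_union, Finset.mem_image, Sym2.eq_iff,
        forall_eq_or_imp, forall_eq]
      constructor
      · rintro ⟨hxy, hx | hx, hy | hy⟩
        · exact absurd (hx.trans hy.symm) hxy.ne
        · exact Or.inr ⟨y, ⟨hy, hx ▸ hxy⟩, Or.inl ⟨hx.symm, rfl⟩⟩
        · exact Or.inr ⟨x, ⟨hx, hy ▸ hxy.symm⟩, Or.inr ⟨hy.symm, rfl⟩⟩
        · exact Or.inl ⟨hxy, hx, hy⟩
      · rintro (⟨hxy, hx, hy⟩ | ⟨z, ⟨hz, hwz⟩, ⟨rfl, rfl⟩ | ⟨rfl, rfl⟩⟩)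
        · exact ⟨hxy, Or.inr hx, Or.inr hy⟩
        · exact ⟨hwz, Or.inl rfl, Or.inr hz⟩
        · exact ⟨hwz.symm, Or.inr hz, Or.inl rfl⟩
  · rw [Finset.disjoint_left]
    intro e he he'
    obtain ⟨z, hz, rfl⟩ := Finset.mem_image.1 he'
    exact hw ((Finset.mem_filter.1 he).2 w (by simp))

theorem fieldWeight_insert_insert {w : V} {S T : Finset V} (hw : w ∉ S) (hT : T ⊆ S)
    (a b : V → ℕ) :
    fieldWeight G β γ lam (insert w S) a b (insert w T) =
      lam * β ^ a w * fieldWeight G β γ lam S (a + ind (G.neighborFinset w)) b T := by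
  have hwT : w ∉ T := fun h => hw (hT h)
  have h1 : insert w S \ insert w T = S \ T := by grind
  unfold fieldWeight
  rw [h1, Finset.prod_insert hwT, internalEdges_insert G hwT]
  simp only [Pi.add_apply, pow_add, ← mul_assoc, Finset.prod_mul_distrib, Finset.prod_pow_eq_pow_sum]
  ring

theorem fieldWeight_insert {w : V} {S T : Finset V} (hw : w ∉ S) (hT : T ⊆ S)
    (a b : V → ℕ) :
    fieldWeight G β γ lam (insert w S) a b T =
      γ ^ b w * fieldWeight G β γ lam S a (b + ind (G.neighborFinset w)) T := by
  have hwT : w ∉ T := fun h => hw (hT h)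
  have hwS : w ∉ S \ T := fun h => hw (Finset.mem_sdiff.1 h).1
  have h1 : insert w S \ T = insert w (S \ T) := by grind
  unfold fieldWeight
  rw [h1, Finset.prod_insert hwS, internalEdges_insert G hwS]
  simp only [Pi.add_apply, pow_add, Finset.prod_mul_distrib, Finset.prod_pow_eq_pow_sum]
  ring

/-- Splitting on the spin of `w`, whose edges into `S` become boundary counts. The test function `f`
lets one identity serve partition functions, marginals and pinnings. -/
theorem sum_fieldWeight_insert {w : V} {S : Finset V} (hw : w ∉ S) (a b : V → ℕ)
    (f : Finset V → ℝ) :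
    ∑ T ∈ (insert w S).powerset, fieldWeight G β γ lam (insert w S) a b T * f T =
      lam * β ^ a w * ∑ T ∈ S.powerset,
        fieldWeight G β γ lam S (a + ind (G.neighborFinset w)) b T * f (insert w T) +
      γ ^ b w * ∑ T ∈ S.powerset,
        fieldWeight G β γ lam S a (b + ind (G.neighborFinset w)) T * f T := by
  rw [Finset.sum_powerset_insert hw, add_comm, Finset.mul_sum, Finset.mul_sum]
  congr 1
  · refine Finset.sum_congr rfl fun T hT => ?_
    rw [fieldWeight_insert_insert G β γ lam hw (Finset.mem_powerset.1 hT), mul_assoc]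
  · refine Finset.sum_congr rfl fun T hT => ?_
    rw [fieldWeight_insert G β γ lam hw (Finset.mem_powerset.1 hT), mul_assoc]

theorem fieldZ_insert {w : V} {S : Finset V} (hw : w ∉ S) (a b : V → ℕ) :
    fieldZ G β γ lam (insert w S) a b =
      lam * β ^ a w * fieldZ G β γ lam S (a + ind (G.neighborFinset w)) b +
      γ ^ b w * fieldZ G β γ lam S a (b + ind (G.neighborFinset w)) := by
  simpa [fieldZ] using sum_fieldWeight_insert G β γ lam hw a b fun _ => 1

theorem fieldZAt_insert_of_ne {w u : V} {S : Finset V} (hw : w ∉ S) (hu : u ≠ w) (a b : V → ℕ) :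
    fieldZAt G β γ lam (insert w S) a b u =
      lam * β ^ a w * fieldZAt G β γ lam S (a + ind (G.neighborFinset w)) b u +
      γ ^ b w * fieldZAt G β γ lam S a (b + ind (G.neighborFinset w)) u := by
  simpa [fieldZAt, hu] using sum_fieldWeight_insert G β γ lam hw a b fun T => if u ∈ T then 1 else 0

theorem fieldZAt_insert_self {w : V} {S : Finset V} (hw : w ∉ S) (a b : V → ℕ) :
    fieldZAt G β γ lam (insert w S) a b w =
      lam * β ^ a w * fieldZ G β γ lam S (a + ind (G.neighborFinset w)) b := by
  have h0 : ∑ T ∈ S.powerset, (if w ∈ T then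
      fieldWeight G β γ lam S a (b + ind (G.neighborFinset w)) T else 0) = 0 :=
    Finset.sum_eq_zero fun T hT => if_neg fun h => hw (Finset.mem_powerset.1 hT h)
  simpa [fieldZAt, fieldZ, h0] using
    sum_fieldWeight_insert G β γ lam hw a b fun T => if w ∈ T then 1 else 0

omit [DecidableRel G.Adj] in
theorem fieldWeight_congr {S : Finset V} {a b a' b' : V → ℕ} (ha : ∀ v ∈ S, a v = a' v)
    (hb : ∀ v ∈ S, b v = b' v) {T : Finset V} (hT : T ⊆ S) :
    fieldWeight G β γ lam S a b T = fieldWeight G β γ lam S a' b' T := by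
  have h1 : ∏ v ∈ T, lam * β ^ a v = ∏ v ∈ T, lam * β ^ a' v :=
    Finset.prod_congr rfl fun v hv => by rw [ha v (hT hv)]
  have h2 : ∏ v ∈ S \ T, γ ^ b v = ∏ v ∈ S \ T, γ ^ b' v :=
    Finset.prod_congr rfl fun v hv => by rw [hb v (Finset.mem_sdiff.1 hv).1]
  rw [fieldWeight, fieldWeight, h1, h2]

omit [DecidableRel G.Adj] in
theorem fieldZ_congr {S : Finset V} {a b a' b' : V → ℕ} (ha : ∀ v ∈ S, a v = a' v)
    (hb : ∀ v ∈ S, b v = b' v) : fieldZ G β γ lam S a b = fieldZ G β γ lam S a' b' :=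
  Finset.sum_congr rfl fun _ hT => fieldWeight_congr G β γ lam ha hb (Finset.mem_powerset.1 hT)

omit [DecidableRel G.Adj] in
theorem fieldZAt_congr {S : Finset V} {a b a' b' : V → ℕ} (ha : ∀ v ∈ S, a v = a' v)
    (hb : ∀ v ∈ S, b v = b' v) (u : V) :
    fieldZAt G β γ lam S a b u = fieldZAt G β γ lam S a' b' u :=
  Finset.sum_congr rfl fun _ hT => by
    rw [fieldWeight_congr G β γ lam ha hb (Finset.mem_powerset.1 hT)]

omit [DecidableRel G.Adj] in
theorem fieldMarginal_congr {S : Finset V} {a b a' b' : V → ℕ} (ha : ∀ v ∈ S, a v = a' v)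
    (hb : ∀ v ∈ S, b v = b' v) (u : V) :
    fieldMarginal G β γ lam S a b u = fieldMarginal G β γ lam S a' b' u := by
  rw [fieldMarginal, fieldMarginal, fieldZ_congr G β γ lam ha hb, fieldZAt_congr G β γ lam ha hb]

variable {β γ lam}

omit [DecidableRel G.Adj] in
theorem fieldWeight_nonneg (hβ : 0 ≤ β) (hγ : 0 < γ) (hlam : 0 < lam) (S : Finset V)
    (a b : V → ℕ) (T : Finset V) : 0 ≤ fieldWeight G β γ lam S a b T := by
  unfold fieldWeight
  have := Finset.prod_nonneg (s := T) (f := fun v => lam * β ^ a v) fun v _ => by positivity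
  have := Finset.prod_nonneg (s := S \ T) (f := fun v => γ ^ b v) fun v _ => by positivity
  positivity

-- The all-`-1` configuration has positive weight even when `β = 0`.
omit [DecidableRel G.Adj] in
theorem fieldZ_pos (hβ : 0 ≤ β) (hγ : 0 < γ) (hlam : 0 < lam) (S : Finset V)
    (a b : V → ℕ) : 0 < fieldZ G β γ lam S a b := by
  refine Finset.sum_pos' (fun T _ => fieldWeight_nonneg G hβ hγ hlam S a b T)
    ⟨∅, Finset.empty_mem_powerset S, ?_⟩
  have h0 : internalEdges G (∅ : Finset V) = 0 := by
    unfold internalEdges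
    rw [Finset.card_eq_zero, Finset.filter_eq_empty_iff]
    intro e _ h
    induction e with
    | _ x y => simpa using h x (by simp)
  have := Finset.prod_pos (s := S \ ∅) (f := fun v => γ ^ b v) fun v _ => by positivity
  unfold fieldWeight
  rw [h0]
  simp only [Finset.prod_empty, pow_zero, mul_one, one_mul]
  positivity

theorem fieldRatio_nonneg (hβ : 0 ≤ β) (hγ : 0 < γ) (hlam : 0 < lam) (S : Finset V)
    (a b : V → ℕ) (w : V) : 0 ≤ fieldRatio G β γ lam S a b w := by
  have h1 := fieldZ_pos G hβ hγ hlam S (a + ind (G.neighborFinset w)) b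
  have h2 := fieldZ_pos G hβ hγ hlam S a (b + ind (G.neighborFinset w))
  unfold fieldRatio
  positivity

/-- Changing one pinned neighbour of `j` from `-1` to `+1`. -/
theorem single_flip (hβ : 0 ≤ β) (hγ : 0 < γ) (hlam : 0 < lam) {S : Finset V} {j : V}
    (hj : j ∈ S) (a b : V → ℕ) :
    fieldZ G β γ lam S (a + ind {j}) b = fieldZ G β γ lam S a (b + ind {j}) *
      ((β * fieldRatio G β γ lam (S.erase j) a b j + 1) /
        (fieldRatio G β γ lam (S.erase j) a b j + γ)) ∧
    ∀ u, fieldMarginal G β γ lam S (a + ind {j}) b u -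
        fieldMarginal G β γ lam S a (b + ind {j}) u =
      ratioDeriv β γ (fieldRatio G β γ lam (S.erase j) a b j) *
        fieldInfluence G β γ lam (S.erase j) a b j u := by
  obtain ⟨S', hjS, rfl⟩ : ∃ S', j ∉ S' ∧ insert j S' = S :=
    ⟨S.erase j, Finset.notMem_erase j S, Finset.insert_erase hj⟩
  rw [Finset.erase_insert hjS]
  set N := ind (G.neighborFinset j)
  have hne : ∀ v ∈ S', v ∉ ({j} : Finset V) := fun v hv h =>
    hjS (Finset.mem_singleton.1 h ▸ hv)
  have c1 : ∀ v ∈ S', (a + ind {j} + N) v = (a + N) v := fun v hv => by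
    simp [ind_of_notMem (hne v hv)]
  have c2 : ∀ v ∈ S', (a + ind {j}) v = a v := fun v hv => by
    simp [ind_of_notMem (hne v hv)]
  have c3 : ∀ v ∈ S', (b + ind {j} + N) v = (b + N) v := fun v hv => by
    simp [ind_of_notMem (hne v hv)]
  have c4 : ∀ v ∈ S', (b + ind {j}) v = b v := fun v hv => by
    simp [ind_of_notMem (hne v hv)]
  have hjj : ind ({j} : Finset V) j = 1 := ind_of_mem (by simp)
  have zp := fieldZ_pos G hβ hγ hlam S' (a + N) b
  have zm := fieldZ_pos G hβ hγ hlam S' a (b + N)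
  -- With `X`, `Y` the weights of the spins `+1`, `-1` at `j` before the extra neighbour is added,
  -- the ratio is `X / Y`, and the two partition functions are `β X + Y` and `X + γ Y`.
  have e1 : fieldZ G β γ lam (insert j S') (a + ind {j}) b =
      β * (lam * β ^ a j * fieldZ G β γ lam S' (a + N) b) +
        γ ^ b j * fieldZ G β γ lam S' a (b + N) := by
    rw [fieldZ_insert G β γ lam hjS, fieldZ_congr G β γ lam c1 fun _ _ => rfl,
      fieldZ_congr G β γ lam c2 fun _ _ => rfl, Pi.add_apply, hjj, pow_succ]
    ring
  have e2 : fieldZ G β γ lam (insert j S') a (b + ind {j}) =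
      lam * β ^ a j * fieldZ G β γ lam S' (a + N) b +
        γ * (γ ^ b j * fieldZ G β γ lam S' a (b + N)) := by
    rw [fieldZ_insert G β γ lam hjS, fieldZ_congr G β γ lam (fun _ _ => rfl) c3,
      fieldZ_congr G β γ lam (fun _ _ => rfl) c4, Pi.add_apply, hjj, pow_succ]
    ring
  have hX : 0 ≤ lam * β ^ a j * fieldZ G β γ lam S' (a + N) b := by positivity
  have hY : 0 < γ ^ b j * fieldZ G β γ lam S' a (b + N) := by positivity
  constructor
  · rw [e1, e2, fieldRatio]
    set X := lam * β ^ a j * fieldZ G β γ lam S' (a + N) b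
    set Y := γ ^ b j * fieldZ G β γ lam S' a (b + N)
    have : 0 < X + γ * Y := by positivity
    field_simp
  · intro u
    by_cases hu : u = j
    · subst hu
      rw [fieldInfluence, if_pos rfl, fieldMarginal, fieldMarginal, e1, e2,
        fieldZAt_insert_self G β γ lam hjS, fieldZAt_insert_self G β γ lam hjS,
        fieldZ_congr G β γ lam c1 fun _ _ => rfl, fieldZ_congr G β γ lam (fun _ _ => rfl) c4,
        Pi.add_apply, hjj, pow_succ, fieldRatio, ratioDeriv,
        show lam * (β ^ a u * β) * fieldZ G β γ lam S' (a + N) b =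
          β * (lam * β ^ a u * fieldZ G β γ lam S' (a + N) b) by ring]
      set X := lam * β ^ a u * fieldZ G β γ lam S' (a + N) b
      set Y := γ ^ b u * fieldZ G β γ lam S' a (b + N)
      have h1 : 0 < X + γ * Y := by positivity
      have h2 : 0 < β * X + Y := by positivity
      field_simp
      ring
    · rw [fieldInfluence, if_neg hu, fieldMarginal, fieldMarginal, e1, e2,
        fieldZAt_insert_of_ne G β γ lam hjS hu, fieldZAt_insert_of_ne G β γ lam hjS hu,
        fieldZAt_congr G β γ lam c1 fun _ _ => rfl, fieldZAt_congr G β γ lam (fun _ _ => rfl) c4,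
        fieldZAt_congr G β γ lam c2 fun _ _ => rfl, fieldZAt_congr G β γ lam (fun _ _ => rfl) c3,
        Pi.add_apply, Pi.add_apply, hjj, pow_succ, pow_succ, fieldRatio, ratioDeriv]
      -- In terms of the marginals `p`, `q` at `u` given `+1`, `-1` at `j`, the difference of two
      -- weighted averages factors as `h(X / Y) * (p - q)`.
      have m1 : fieldZAt G β γ lam S' (a + N) b u =
          fieldMarginal G β γ lam S' (a + N) b u * fieldZ G β γ lam S' (a + N) b := by
        rw [fieldMarginal]; field_simp
      have m2 : fieldZAt G β γ lam S' a (b + N) u =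
          fieldMarginal G β γ lam S' a (b + N) u * fieldZ G β γ lam S' a (b + N) := by
        rw [fieldMarginal]; field_simp
      rw [m1, m2]
      set p := fieldMarginal G β γ lam S' (a + N) b u
      set q := fieldMarginal G β γ lam S' a (b + N) u
      rw [show lam * (β ^ a j * β) * (p * fieldZ G β γ lam S' (a + N) b) =
          β * p * (lam * β ^ a j * fieldZ G β γ lam S' (a + N) b) by ring,
        show lam * β ^ a j * (p * fieldZ G β γ lam S' (a + N) b) =
          p * (lam * β ^ a j * fieldZ G β γ lam S' (a + N) b) by ring,
        show γ ^ b j * (q * fieldZ G β γ lam S' a (b + N)) =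
          q * (γ ^ b j * fieldZ G β γ lam S' a (b + N)) by ring,
        show γ ^ b j * γ * (q * fieldZ G β γ lam S' a (b + N)) =
          γ * q * (γ ^ b j * fieldZ G β γ lam S' a (b + N)) by ring]
      set X := lam * β ^ a j * fieldZ G β γ lam S' (a + N) b
      set Y := γ ^ b j * fieldZ G β γ lam S' a (b + N)
      have h1 : 0 < X + γ * Y := by positivity
      have h2 : 0 < β * X + Y := by positivity
      field_simp
      ring

/-- Changing the pinned neighbour of every vertex of `N` from `-1` to `+1`, one at a time. -/
theorem exists_flip (hβ : 0 ≤ β) (hγ : 0 < γ) (hlam : 0 < lam) {S : Finset V}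
    (N : Finset V) (hN : N ⊆ S) (a b : V → ℕ) :
    ∃ p q : V → V → ℕ, (∀ i ∈ N, p i + q i = a + b + ind (N.erase i)) ∧
      fieldZ G β γ lam S (a + ind N) b = fieldZ G β γ lam S a (b + ind N) *
        ∏ i ∈ N, ((β * fieldRatio G β γ lam (S.erase i) (p i) (q i) i + 1) /
          (fieldRatio G β γ lam (S.erase i) (p i) (q i) i + γ)) ∧
      ∀ u, fieldMarginal G β γ lam S (a + ind N) b u -
          fieldMarginal G β γ lam S a (b + ind N) u =
        ∑ i ∈ N, ratioDeriv β γ (fieldRatio G β γ lam (S.erase i) (p i) (q i) i) *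
          fieldInfluence G β γ lam (S.erase i) (p i) (q i) i u := by
  induction N using Finset.induction_on generalizing a b with
  | empty =>
    refine ⟨fun _ => 0, fun _ => 0, by simp, ?_, ?_⟩
    · have : ind (∅ : Finset V) = 0 := by ext; simp [ind]
      simp [this]
    · have : ind (∅ : Finset V) = 0 := by ext; simp [ind]
      simp [this]
  | insert j N hj ih =>
    obtain ⟨p, q, hpq, hZ, hM⟩ := ih (fun x hx => hN (Finset.mem_insert_of_mem hx)) (a + ind {j}) b
    obtain ⟨hZ', hM'⟩ := single_flip G hβ hγ hlam (hN (Finset.mem_insert_self j N)) a (b + ind N)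
    have hind : ind (insert j N) = ind {j} + ind N := by
      ext u
      simp only [ind, Pi.add_apply, Finset.mem_insert, Finset.mem_singleton]
      by_cases h : u = j
      · subst h; simp [hj]
      · simp [h]
    have hne : ∀ i ∈ N, i ≠ j := fun i hi h => hj (h ▸ hi)
    -- The copies at `N` are flipped while the one at `j` is still `+1`, and `j` is flipped when
    -- those at `N` are already `-1`.
    refine ⟨Function.update p j a, Function.update q j (b + ind N), ?_, ?_, ?_⟩
    · intro i hi
      rcases Finset.mem_insert.1 hi with rfl | hi
      · simp [Finset.erase_insert hj, add_assoc]
      · have h1 : (insert j N).erase i = insert j (N.erase i) := by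
          have := hne i hi
          grind
        have h2 : ind (insert j (N.erase i)) = ind {j} + ind (N.erase i) := by
          ext u
          simp only [ind, Pi.add_apply, Finset.mem_insert, Finset.mem_singleton]
          by_cases h : u = j
          · subst h; simp [hj]
          · simp [h]
        rw [Function.update_of_ne (hne i hi), Function.update_of_ne (hne i hi), hpq i hi, h1, h2]
        ext u
        simp only [Pi.add_apply]
        ring
    · rw [Finset.prod_insert hj, Function.update_self, Function.update_self,
        Finset.prod_congr rfl fun i hi => by
          rw [Function.update_of_ne (hne i hi), Function.update_of_ne (hne i hi)],
        hind, ← add_assoc, hZ, hZ', add_comm (ind {j}) (ind N), ← add_assoc]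
      ring
    · intro u
      rw [Finset.sum_insert hj, Function.update_self, Function.update_self,
        Finset.sum_congr rfl fun i hi => by
          rw [Function.update_of_ne (hne i hi), Function.update_of_ne (hne i hi)],
        ← hM u, ← hM' u, hind, ← add_assoc, add_comm (ind {j}) (ind N), ← add_assoc]
      ring

end Model

/-! ### The recursion for ratios and total influences -/

section Recursion

variable {V : Type*} [Fintype V] [DecidableEq V] (G : SimpleGraph V) [DecidableRel G.Adj]
  {β γ lam : ℝ}

/-- The total influence of `w`, weighted by `x`, in the system on `insert w S`. -/
noncomputable def totalInfluence (β γ lam : ℝ) (x : V → ℝ) (S : Finset V) (a b : V → ℕ)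
    (w : V) : ℝ :=
  ∑ u ∈ insert w S, |fieldInfluence G β γ lam S a b w u| * x u

theorem totalInfluence_nonneg {x : V → ℝ} (hx : ∀ v, 0 ≤ x v) (S : Finset V) (a b : V → ℕ)
    (w : V) : 0 ≤ totalInfluence G β γ lam x S a b w :=
  Finset.sum_nonneg fun u _ => mul_nonneg (abs_nonneg _) (hx u)

/-- One level of the self-avoiding-walk tree: flipping all neighbours of `w` in `S` gives the ratio
as a product and, by the triangle inequality, the total influence as a sum over the same children.
-/
theorem exists_children (hβ : 0 ≤ β) (hγ : 0 < γ) (hlam : 0 < lam) {x : V → ℝ}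
    (hx : ∀ v, 0 ≤ x v) {S : Finset V} {w : V} (hw : w ∉ S) (a b : V → ℕ) :
    ∃ p q : V → V → ℕ,
      (∀ i ∈ G.neighborFinset w ∩ S,
        p i + q i = a + b + ind ((G.neighborFinset w ∩ S).erase i)) ∧
      fieldRatio G β γ lam S a b w = lam * β ^ a w / γ ^ b w *
        ∏ i ∈ G.neighborFinset w ∩ S,
          ((β * fieldRatio G β γ lam (S.erase i) (p i) (q i) i + 1) /
            (fieldRatio G β γ lam (S.erase i) (p i) (q i) i + γ)) ∧
      totalInfluence G β γ lam x S a b w ≤ x w + ∑ i ∈ G.neighborFinset w ∩ S,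
        |ratioDeriv β γ (fieldRatio G β γ lam (S.erase i) (p i) (q i) i)| *
          totalInfluence G β γ lam x (S.erase i) (p i) (q i) i := by
  obtain ⟨p, q, hpq, hZ, hM⟩ :=
    exists_flip G hβ hγ hlam (G.neighborFinset w ∩ S) Finset.inter_subset_right a b
  set N := G.neighborFinset w ∩ S with hN
  have hind : ∀ v ∈ S, ind (G.neighborFinset w) v = ind N v := fun v hv => by
    simp [ind, hN, hv]
  have ca : ∀ v ∈ S, (a + ind (G.neighborFinset w)) v = (a + ind N) v := fun v hv => by
    simp [hind v hv]
  have cb : ∀ v ∈ S, (b + ind (G.neighborFinset w)) v = (b + ind N) v := fun v hv => by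
    simp [hind v hv]
  refine ⟨p, q, hpq, ?_, ?_⟩
  · have h2 := fieldZ_pos G hβ hγ hlam S a (b + ind N)
    rw [fieldRatio, fieldZ_congr G β γ lam ca fun _ _ => rfl,
      fieldZ_congr G β γ lam (fun _ _ => rfl) cb, hZ]
    field_simp
  · have hI : ∀ u ∈ S, fieldInfluence G β γ lam S a b w u = ∑ i ∈ N,
        ratioDeriv β γ (fieldRatio G β γ lam (S.erase i) (p i) (q i) i) *
          fieldInfluence G β γ lam (S.erase i) (p i) (q i) i u := fun u hu => by
      have huw : u ≠ w := fun h => hw (h ▸ hu)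
      rw [fieldInfluence, if_neg huw, fieldMarginal_congr G β γ lam ca fun _ _ => rfl,
        fieldMarginal_congr G β γ lam (fun _ _ => rfl) cb, hM]
    rw [totalInfluence, Finset.sum_insert hw, fieldInfluence, if_pos rfl, abs_one, one_mul]
    gcongr
    calc ∑ u ∈ S, |fieldInfluence G β γ lam S a b w u| * x u
        ≤ ∑ u ∈ S, ∑ i ∈ N,
          |ratioDeriv β γ (fieldRatio G β γ lam (S.erase i) (p i) (q i) i)| *
            (|fieldInfluence G β γ lam (S.erase i) (p i) (q i) i u| * x u) := by
          refine Finset.sum_le_sum fun u hu => ?_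
          rw [hI u hu]
          calc _ ≤ (∑ i ∈ N, |ratioDeriv β γ (fieldRatio G β γ lam (S.erase i) (p i) (q i) i) *
              fieldInfluence G β γ lam (S.erase i) (p i) (q i) i u|) * x u :=
                mul_le_mul_of_nonneg_right (Finset.abs_sum_le_sum_abs _ _) (hx u)
            _ = _ := by
                rw [Finset.sum_mul]
                exact Finset.sum_congr rfl fun i _ => by rw [abs_mul, mul_assoc]
      _ = _ := by
          rw [Finset.sum_comm]
          refine Finset.sum_congr rfl fun i hi => ?_
          rw [totalInfluence, Finset.insert_erase (Finset.mem_inter.1 hi).2, Finset.mul_sum]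

omit [Fintype V] in
theorem card_inter_insert (A : Finset V) {S : Finset V} {w : V} (hw : w ∉ S) :
    (A ∩ insert w S).card = (A ∩ S).card + ind A w := by
  by_cases h : w ∈ A
  · rw [Finset.inter_insert_of_mem h, Finset.card_insert_of_notMem (by simp [hw]), ind_of_mem h]
  · rw [Finset.inter_insert_of_notMem h, ind_of_notMem h, add_zero]

/-- `S`, `a`, `b` record the boundary of `insert w S` correctly at the vertices of `S`. -/
def CountsBoundary (S : Finset V) (a b : V → ℕ) (w : V) : Prop :=
  ∀ u ∈ S, a u + b u + (G.neighborFinset u ∩ insert w S).card = G.degree u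

/-- The vertex `w` has one neighbour that is not recorded by `S`, `a`, `b`. -/
def HasParent (S : Finset V) (a b : V → ℕ) (w : V) : Prop :=
  a w + b w + (G.neighborFinset w ∩ S).card + 1 = G.degree w

/-- Passing to a child keeps the degree bookkeeping: edges from `w` to the siblings become pinned
counts, and only the edge from `w` to `i`, whose copy is being flipped, goes unrecorded. -/
theorem CountsBoundary.child {G : SimpleGraph V} [DecidableRel G.Adj] {S : Finset V}
    {a b : V → ℕ} {w : V} (hw : w ∉ S)
    (h : CountsBoundary G S a b w) {i : V} (hi : i ∈ G.neighborFinset w ∩ S) {p q : V → ℕ}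
    (hpq : p + q = a + b + ind ((G.neighborFinset w ∩ S).erase i)) :
    CountsBoundary G (S.erase i) p q i ∧ HasParent G (S.erase i) p q i := by
  have hiS := (Finset.mem_inter.1 hi).2
  have hiw : G.Adj w i := by simpa using (Finset.mem_inter.1 hi).1
  have hpq' : ∀ u, p u + q u = a u + b u + ind ((G.neighborFinset w ∩ S).erase i) u :=
    fun u => congrFun hpq u
  constructor
  · intro u hu
    have huS := Finset.mem_of_mem_erase hu
    have h1 := h u huS
    rw [card_inter_insert _ hw] at h1
    rw [Finset.insert_erase hiS, hpq']
    have h2 : ind ((G.neighborFinset w ∩ S).erase i) u = ind (G.neighborFinset u) w := by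
      simp [ind, Finset.ne_of_mem_erase hu, huS, G.adj_comm]
    omega
  · have h1 := h i hiS
    rw [card_inter_insert _ hw, ind_of_mem (by simpa using hiw.symm)] at h1
    have h2 : G.neighborFinset i ∩ S.erase i = G.neighborFinset i ∩ S := by
      ext u
      simp only [Finset.mem_inter, SimpleGraph.mem_neighborFinset, Finset.mem_erase]
      exact ⟨fun h => ⟨h.1, h.2.2⟩, fun h => ⟨h.1, h.1.ne', h.2⟩⟩
    rw [HasParent, hpq', h2, ind_of_notMem (by simp)]
    omega

end Recursion

/-! ### Contraction at infinite log-ratios, and the range of the recursion -/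

section Analysis

/-- A bound on a derivative passes to the end points of an interval, although the derivative need
not be continuous. -/
theorem deriv_mul_le_of_mem_closure {Ψ : ℝ → ℝ} (hΨ : Differentiable ℝ Ψ) {I : Set ℝ}
    (hI : I.OrdConnected) {v K L : ℝ} (hv : v ∈ closure I)
    (h : ∀ ξ ∈ I, deriv Ψ ξ * K ≤ L) : deriv Ψ v * K ≤ L := by
  by_cases hvI : v ∈ I
  · exact h v hvI
  have hne : (nhdsWithin v I).NeBot := mem_closure_iff_nhdsWithin_neBot.1 hv
  have hle : nhdsWithin v I ≤ nhdsWithin v {v}ᶜ :=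
    nhdsWithin_mono v fun t ht htv => hvI (htv ▸ ht)
  -- The slopes from `v` to points of `I` converge to the derivative at `v`. By the mean value
  -- theorem each is a derivative at a point `ξ`, which lies in `I` because `I` has points on both
  -- sides of it.
  have hlim := ((hasDerivAt_iff_tendsto_slope.1 (hΨ v).hasDerivAt).mono_left hle).mul_const K
  refine le_of_tendsto hlim ?_
  filter_upwards [self_mem_nhdsWithin] with t ht
  rcases lt_trichotomy v t with hvt | rfl | hvt
  · obtain ⟨ξ, hξ, hd⟩ := exists_deriv_eq_slope Ψ hvt hΨ.continuous.continuousOn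
      hΨ.differentiableOn
    obtain ⟨q, hq, hqI⟩ := mem_closure_iff.1 hv (Set.Iio ξ) isOpen_Iio hξ.1
    rw [slope_def_field, ← hd]
    exact h ξ (hI.out hqI ht ⟨le_of_lt hq, hξ.2.le⟩)
  · exact absurd ht hvI
  · obtain ⟨ξ, hξ, hd⟩ := exists_deriv_eq_slope Ψ hvt hΨ.continuous.continuousOn
      hΨ.differentiableOn
    obtain ⟨q, hq, hqI⟩ := mem_closure_iff.1 hv (Set.Ioi ξ) isOpen_Ioi hξ.2
    rw [slope_comm, slope_def_field, ← hd]
    exact h ξ (hI.out ht hqI ⟨hξ.1.le, le_of_lt hq⟩)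

variable {β γ lam s δ c : ℝ} {Δ : ℕ} {Ψ : ℝ → ℝ}

theorem continuous_log_factor (hβ : 0 ≤ β) (hγ : 0 < γ) :
    Continuous fun t : ℝ => Real.log ((β * Real.exp t + 1) / (Real.exp t + γ)) := by
  have h1 : ∀ t : ℝ, 0 < Real.exp t + γ := fun t => by positivity
  have h2 : ∀ t : ℝ, 0 < (β * Real.exp t + 1) / (Real.exp t + γ) := fun t => by positivity
  refine Continuous.log (Continuous.div (by fun_prop) (by fun_prop) fun t => (h1 t).ne')
    fun t => (h2 t).ne'

/-- The limit is the contribution of a neighbour pinned to `-1`; the limit at `+∞` is that of a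
neighbour pinned to `+1`. -/
theorem tendsto_log_factor_atBot (hγ : 0 < γ) :
    Filter.Tendsto (fun t : ℝ => Real.log ((β * Real.exp t + 1) / (Real.exp t + γ)))
      Filter.atBot (nhds (-Real.log γ)) := by
  rw [← Real.log_inv]
  refine Filter.Tendsto.log ?_ (by positivity)
  have h := ((Real.tendsto_exp_atBot.const_mul β).add_const 1).div
    (Real.tendsto_exp_atBot.add_const γ) (by simpa using hγ.ne')
  simp only [mul_zero, zero_add, one_div] at h
  exact h

theorem tendsto_log_factor_atTop (hβ : 0 < β) (hγ : 0 < γ) :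
    Filter.Tendsto (fun t : ℝ => Real.log ((β * Real.exp t + 1) / (Real.exp t + γ)))
      Filter.atTop (nhds (Real.log β)) := by
  refine Filter.Tendsto.log ?_ (by positivity)
  have h0 := Real.tendsto_exp_neg_atTop_nhds_zero
  have h := (h0.const_add β).div ((h0.const_mul γ).const_add 1) (by simp)
  simp only [add_zero, mul_zero, div_one] at h
  refine h.congr fun t => ?_
  have h1 : 0 < Real.exp t := Real.exp_pos t
  simp only [Pi.div_apply, Real.exp_neg]
  have h2 : 0 < Real.exp t + γ := by positivity
  field_simp

/-- The contraction inequality at boundary values of the recursion. -/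
theorem IsPotential.contraction_limit (hΨ : IsPotential s δ c Δ β γ lam Ψ) (hβ : 0 ≤ β)
    (hγ : 0 < γ) (hs : 1 ≤ s) {a b k : ℕ} (ha : a = 0 ∨ 0 < β) (h1 : 1 ≤ k + a + b)
    (h2 : k + a + b < Δ) (y m : Fin k → ℝ) (hm : ∀ j, 0 ≤ m j) :
    deriv Ψ (Real.log lam + a * Real.log β + b * -Real.log γ +
        ∑ i, Real.log ((β * Real.exp (y i) + 1) / (Real.exp (y i) + γ))) *
        ∑ j, |recursionDeriv β γ (y j)| / deriv Ψ (y j) * m j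
      ≤ δ ^ (1 / s) * (∑ j, m j ^ s) ^ (1 / s) := by
  -- A pinned neighbour is the limit of a free argument `z` with `m`-weight `0`. That argument drops
  -- out of both sums and only moves the point where `deriv Ψ` is evaluated.
  have key : ∀ (B t : ℝ) {k : ℕ} (y m : Fin k → ℝ),
      t ∈ closure (Set.range fun t : ℝ => Real.log ((β * Real.exp t + 1) / (Real.exp t + γ))) →
      (∀ z : ℝ, deriv Ψ (B + ∑ i, Real.log ((β * Real.exp ((Fin.cons z y : Fin (k + 1) → ℝ) i) + 1) /
          (Real.exp ((Fin.cons z y : Fin (k + 1) → ℝ) i) + γ))) *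
        ∑ j, |recursionDeriv β γ ((Fin.cons z y : Fin (k + 1) → ℝ) j)| /
          deriv Ψ ((Fin.cons z y : Fin (k + 1) → ℝ) j) * (Fin.cons 0 m : Fin (k + 1) → ℝ) j
        ≤ δ ^ (1 / s) * (∑ j, (Fin.cons 0 m : Fin (k + 1) → ℝ) j ^ s) ^ (1 / s)) →
      deriv Ψ (B + t + ∑ i, Real.log ((β * Real.exp (y i) + 1) / (Real.exp (y i) + γ))) *
        ∑ j, |recursionDeriv β γ (y j)| / deriv Ψ (y j) * m j
      ≤ δ ^ (1 / s) * (∑ j, m j ^ s) ^ (1 / s) := by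
    intro B t k y m ht h
    simp only [Fin.sum_univ_succ, Fin.cons_zero, Fin.cons_succ, mul_zero, zero_add,
      Real.zero_rpow (by linarith : s ≠ 0)] at h
    set Q := ∑ i, Real.log ((β * Real.exp (y i) + 1) / (Real.exp (y i) + γ))
    have hcont : Continuous fun z : ℝ => B + z + Q := by fun_prop
    refine deriv_mul_le_of_mem_closure hΨ.differentiable
      (I := (fun z : ℝ => B + z + Q) ''
        Set.range fun t : ℝ => Real.log ((β * Real.exp t + 1) / (Real.exp t + γ))) ?_ ?_ ?_
    · exact ((isPreconnected_range (continuous_log_factor hβ hγ)).image _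
        hcont.continuousOn).ordConnected
    · exact image_closure_subset_closure_image hcont ⟨t, ht, rfl⟩
    · rintro _ ⟨_, ⟨z, rfl⟩, rfl⟩
      have := h z
      rwa [← add_assoc] at this
  induction a generalizing k with
  | zero =>
    induction b generalizing k with
    | zero =>
      have := hΨ.contraction k (by omega) (by omega) y m hm
      simpa [logRecursion] using this
    | succ b ih =>
      have hz := fun z => ih (k := k + 1) (by omega) (by omega) (Fin.cons z y) (Fin.cons 0 m)
        (Fin.cases le_rfl hm)
      have := key _ (-Real.log γ) y m
        (mem_closure_of_tendsto (tendsto_log_factor_atBot hγ)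
          (Filter.Eventually.of_forall fun z => Set.mem_range_self z)) hz
      convert this using 4
      push_cast
      ring
  | succ a ih =>
    have hβ' : 0 < β := by simpa using ha
    have hz := fun z => ih (k := k + 1) (Or.inr hβ') (by omega) (by omega) (Fin.cons z y)
      (Fin.cons 0 m) (Fin.cases le_rfl hm)
    have := key _ (Real.log β) y m
      (mem_closure_of_tendsto (tendsto_log_factor_atTop hβ' hγ)
        (Filter.Eventually.of_forall fun z => Set.mem_range_self z)) hz
    convert this using 4
    push_cast
    ring

theorem recursionDeriv_log {r : ℝ} (hr : 0 < r) :
    recursionDeriv β γ (Real.log r) = ratioDeriv β γ r := by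
  rw [recursionDeriv, ratioDeriv, Real.exp_log hr]

theorem ratioDeriv_zero : ratioDeriv β γ 0 = 0 := by simp [ratioDeriv]

/-- The contraction inequality in terms of ratios, some of which may vanish. -/
theorem IsPotential.contraction_ratio {ι : Type*} (hΨ : IsPotential s δ c Δ β γ lam Ψ)
    (hβ : 0 ≤ β) (hγ : 0 < γ) (hlam : 0 < lam) (hs : 1 ≤ s) (hδ : 0 ≤ δ) {a b : ℕ} (N : Finset ι)
    (h1 : 1 ≤ a + b + N.card) (h2 : a + b + N.card < Δ) {r m : ι → ℝ} (hr : ∀ i, 0 ≤ r i)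
    (hm : ∀ i, 0 ≤ m i)
    (hR : 0 < lam * β ^ a / γ ^ b * ∏ i ∈ N, ((β * r i + 1) / (r i + γ))) :
    deriv Ψ (Real.log (lam * β ^ a / γ ^ b * ∏ i ∈ N, ((β * r i + 1) / (r i + γ)))) *
        ∑ i ∈ N, |ratioDeriv β γ (r i)| / deriv Ψ (Real.log (r i)) * m i
      ≤ δ ^ (1 / s) * (∑ i ∈ N, m i ^ s) ^ (1 / s) := by
  classical
  set P := N.filter fun i => 0 < r i with hP
  set Q := N.filter fun i => ¬ 0 < r i with hQ
  have hcard : P.card + Q.card = N.card := Finset.card_filter_add_card_filter_not _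
  have hrP : ∀ i ∈ P, 0 < r i := fun i hi => (Finset.mem_filter.1 hi).2
  have hrQ : ∀ i ∈ Q, r i = 0 := fun i hi =>
    le_antisymm (not_lt.1 (Finset.mem_filter.1 hi).2) (hr i)
  -- A child of ratio `0` contributes the factor `1 / γ`, exactly like a neighbour pinned to `-1`,
  -- so `Q.card` is added to `b` below.
  have hprod : ∏ i ∈ N, ((β * r i + 1) / (r i + γ)) =
      (∏ i ∈ P, ((β * r i + 1) / (r i + γ))) * (1 / γ) ^ Q.card := by
    rw [← Finset.prod_filter_mul_prod_filter_not N (fun i => 0 < r i), ← hP, ← hQ]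
    congr 1
    rw [Finset.prod_congr rfl fun i hi => by rw [hrQ i hi], Finset.prod_const]
    simp
  have hfac : ∀ i ∈ P, 0 < (β * r i + 1) / (r i + γ) := fun i hi => by
    have := hrP i hi
    positivity
  -- A positive ratio rules out neighbours pinned to `+1` when `β = 0`, the one case in which the
  -- limit at `+∞` is not finite.
  have ha : a = 0 ∨ 0 < β := by
    rcases Nat.eq_zero_or_pos a with h | h
    · exact Or.inl h
    · refine Or.inr (lt_of_le_of_ne hβ fun h0 => ?_)
      rw [← h0, zero_pow h.ne'] at hR
      simp at hR
  have hβa : 0 < β ^ a := by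
    rcases ha with rfl | h
    · simp
    · positivity
  have hlog : Real.log (lam * β ^ a / γ ^ b * ∏ i ∈ N, ((β * r i + 1) / (r i + γ))) =
      Real.log lam + a * Real.log β + (b + Q.card : ℕ) * -Real.log γ +
        ∑ i ∈ P, Real.log ((β * r i + 1) / (r i + γ)) := by
    have hpp := Finset.prod_pos hfac
    rw [hprod, Real.log_mul (by positivity) (by positivity), Real.log_mul hpp.ne' (by positivity),
      Real.log_div (by positivity) (by positivity), Real.log_mul hlam.ne' hβa.ne',
      Real.log_pow, Real.log_pow, Real.log_pow, Real.log_prod fun i hi => (hfac i hi).ne',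
      one_div, Real.log_inv]
    push_cast
    ring
  have hsum : ∑ i ∈ N, |ratioDeriv β γ (r i)| / deriv Ψ (Real.log (r i)) * m i =
      ∑ i ∈ P, |ratioDeriv β γ (r i)| / deriv Ψ (Real.log (r i)) * m i := by
    rw [← Finset.sum_filter_add_sum_filter_not N (fun i => 0 < r i), ← hP, ← hQ]
    rw [Finset.sum_eq_zero (s := Q) fun i hi => by rw [hrQ i hi, ratioDeriv_zero]; simp, add_zero]
  have tr : ∀ F : ι → ℝ, ∑ j : Fin P.card, F (P.equivFin.symm j) = ∑ i ∈ P, F i := fun F => by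
    rw [← Finset.sum_coe_sort P, ← Equiv.sum_comp P.equivFin.symm]
  have hmain := hΨ.contraction_limit hβ hγ hs (a := a) (b := b + Q.card) (k := P.card) ha
    (by omega) (by omega) (fun j => Real.log (r (P.equivFin.symm j)))
    (fun j => m (P.equivFin.symm j)) fun j => hm _
  have e1 : ∑ i ∈ P, Real.log ((β * Real.exp (Real.log (r i)) + 1) /
      (Real.exp (Real.log (r i)) + γ)) = ∑ i ∈ P, Real.log ((β * r i + 1) / (r i + γ)) :=
    Finset.sum_congr rfl fun i hi => by rw [Real.exp_log (hrP i hi)]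
  have e2 : ∑ i ∈ P, |recursionDeriv β γ (Real.log (r i))| / deriv Ψ (Real.log (r i)) * m i =
      ∑ i ∈ P, |ratioDeriv β γ (r i)| / deriv Ψ (Real.log (r i)) * m i :=
    Finset.sum_congr rfl fun i hi => by rw [recursionDeriv_log (hrP i hi)]
  rw [tr fun i => Real.log ((β * Real.exp (Real.log (r i)) + 1) / (Real.exp (Real.log (r i)) + γ)),
    tr fun i => |recursionDeriv β γ (Real.log (r i))| / deriv Ψ (Real.log (r i)) * m i,
    tr fun i => m i ^ s,
    e1, e2, ← hlog, ← hsum] at hmain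
  refine hmain.trans ?_
  have hnn : 0 ≤ ∑ i ∈ P, m i ^ s := Finset.sum_nonneg fun i _ => Real.rpow_nonneg (hm i) s
  gcongr
  · exact fun i _ _ => Real.rpow_nonneg (hm i) s
  · exact Finset.filter_subset _ _

/-- Each factor lies between its value `1 / γ` at ratio `0` and its limit `β` at ratio `∞`; the sign
of `1 - β γ` decides which is larger. -/
theorem log_mem_logRatioInterval {ι : Type*} (hβ : 0 ≤ β) (hγ : 0 < γ) (hlam : 0 < lam)
    {a b : ℕ} (N : Finset ι) {r : ι → ℝ} (hr : ∀ i, 0 ≤ r i)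
    (hR : 0 < lam * β ^ a / γ ^ b * ∏ i ∈ N, ((β * r i + 1) / (r i + γ))) :
    Real.log (lam * β ^ a / γ ^ b * ∏ i ∈ N, ((β * r i + 1) / (r i + γ))) ∈
      logRatioInterval β γ lam (a + b + N.card) := by
  have hf0 : ∀ i, 0 ≤ (β * r i + 1) / (r i + γ) := fun i => by
    have := hr i
    positivity
  have hR' : lam * β ^ a / γ ^ b * ∏ i ∈ N, ((β * r i + 1) / (r i + γ)) =
      lam * (β ^ a * (1 / γ) ^ b * ∏ i ∈ N, ((β * r i + 1) / (r i + γ))) := by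
    rw [one_div, inv_pow]; ring
  have hdiv : lam / γ ^ (a + b + N.card) = lam * (1 / γ) ^ (a + b + N.card) := by
    rw [one_div, inv_pow]; ring
  have hγ' : 0 ≤ 1 / γ := by positivity
  have bounds : ∀ {l u : ℝ}, 0 ≤ l → l ≤ β → l ≤ 1 / γ → β ≤ u → 1 / γ ≤ u →
      (∀ i, l ≤ (β * r i + 1) / (r i + γ)) → (∀ i, (β * r i + 1) / (r i + γ) ≤ u) →
      lam * l ^ (a + b + N.card) ≤
        lam * (β ^ a * (1 / γ) ^ b * ∏ i ∈ N, ((β * r i + 1) / (r i + γ))) ∧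
      lam * (β ^ a * (1 / γ) ^ b * ∏ i ∈ N, ((β * r i + 1) / (r i + γ))) ≤
        lam * u ^ (a + b + N.card) := by
    intro l u hl h1 h2 h3 h4 h5 h6
    have hu : 0 ≤ u := hβ.trans h3
    have hp0 : 0 ≤ ∏ i ∈ N, ((β * r i + 1) / (r i + γ)) := Finset.prod_nonneg fun i _ => hf0 i
    have hp1 : l ^ N.card ≤ ∏ i ∈ N, ((β * r i + 1) / (r i + γ)) := by
      rw [← Finset.prod_const]
      exact Finset.prod_le_prod (fun _ _ => hl) fun i _ => h5 i
    have hp2 : ∏ i ∈ N, ((β * r i + 1) / (r i + γ)) ≤ u ^ N.card := by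
      rw [← Finset.prod_const]
      exact Finset.prod_le_prod (fun i _ => hf0 i) fun i _ => h6 i
    rw [pow_add, pow_add, pow_add, pow_add]
    constructor <;> gcongr
  unfold logRatioInterval
  split_ifs with h
  · have hle : β ≤ 1 / γ := by rw [le_div_iff₀ hγ]; exact h.le
    rw [Set.mem_ofPred_eq, Real.exp_log hR, hR', hdiv]
    refine bounds hβ le_rfl hle hle le_rfl (fun i => ?_) fun i => ?_
    · have := hr i
      rw [le_div_iff₀ (by positivity)]
      nlinarith
    · have := hr i
      rw [div_le_div_iff₀ (by positivity) hγ]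
      nlinarith
  · rw [not_lt] at h
    have hle : 1 / γ ≤ β := by rw [div_le_iff₀ hγ]; exact h
    rw [Set.mem_ofPred_eq, Real.exp_log hR, hR', hdiv]
    refine bounds hγ' hle le_rfl le_rfl hle (fun i => ?_) fun i => ?_
    · have := hr i
      rw [div_le_div_iff₀ hγ (by positivity)]
      nlinarith
    · have := hr i
      rw [div_le_iff₀ (by positivity)]
      nlinarith

end Analysis

/-! ### Decay of the weighted total influence -/

section Decay

variable {V : Type*} [Fintype V] [DecidableEq V] {G : SimpleGraph V} [DecidableRel G.Adj]
  {β γ lam s δ c ϱ κ M : ℝ} {Δ : ℕ} {Ψ : ℝ → ℝ} {J : Set ℝ} {x : V → ℝ}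

/-- The parent leaves fewer than `Δ` factors in the ratio. With no factor at all the vertex is a
leaf of `G` and its log-ratio is `log lam`, which the union over `d ≥ 1` need not contain. -/
theorem log_fieldRatio_mem (hβ : 0 ≤ β) (hγ : 0 < γ) (hlam : 0 < lam)
    (hdeg : ∀ v, G.degree v ≤ Δ) (hJ : logRatioRange β γ lam Δ ⊆ J)
    (hleaf : ∀ v, G.degree v = 1 → Real.log lam ∈ J) {S : Finset V} {a b : V → ℕ} {w : V}
    (hw : w ∉ S) (hpar : HasParent G S a b w) (hR : 0 < fieldRatio G β γ lam S a b w) :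
    Real.log (fieldRatio G β γ lam S a b w) ∈ J := by
  obtain ⟨p, q, -, hrec, -⟩ :=
    exists_children G hβ hγ hlam (x := fun _ => 0) (fun _ => le_rfl) hw a b
  have hd := hdeg w
  rw [HasParent] at hpar
  rcases Nat.eq_zero_or_pos (a w + b w + (G.neighborFinset w ∩ S).card) with h0 | h0
  · have ha : a w = 0 := by omega
    have hb : b w = 0 := by omega
    have hN : G.neighborFinset w ∩ S = ∅ := Finset.card_eq_zero.1 (by omega)
    rw [hrec, ha, hb, hN]
    simpa using hleaf w (by omega)
  · rw [hrec] at hR ⊢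
    exact hJ ⟨_, h0, by omega, log_mem_logRatioInterval hβ hγ hlam _
      (fun i => fieldRatio_nonneg G hβ hγ hlam _ _ _ i) hR⟩

/-- Decay of the total influence of a vertex with a parent. -/
theorem deriv_mul_totalInfluence_le (hβ : 0 ≤ β) (hγ : 0 < γ) (hlam : 0 < lam) (hs : 1 ≤ s)
    (hδ : 0 ≤ δ) (hΨ : IsPotential s δ c Δ β γ lam Ψ)
    (hdeg : ∀ v, G.degree v ≤ Δ) (hJ : logRatioRange β γ lam Δ ⊆ J)
    (hleaf : ∀ v, G.degree v = 1 → Real.log lam ∈ J) (hM : ∀ z ∈ J, deriv Ψ z ≤ M)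
    (hM0 : 0 ≤ M) (hϱ : 0 ≤ ϱ) (hx : ∀ v, 0 ≤ x v)
    (hperron : ∀ v, ∑ u ∈ G.neighborFinset v, x u ^ s ≤ ϱ * x v ^ s)
    (hκ : (δ * ϱ) ^ (1 / s) ≤ κ) (hκ1 : κ < 1) (S : Finset V) (a b : V → ℕ) (w : V)
    (hw : w ∉ S)
    (hcount : CountsBoundary G S a b w) (hpar : HasParent G S a b w)
    (hR : 0 < fieldRatio G β γ lam S a b w) :
    deriv Ψ (Real.log (fieldRatio G β γ lam S a b w)) * totalInfluence G β γ lam x S a b w ≤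
      (1 - κ)⁻¹ * M * x w := by
  induction S using Finset.strongInduction generalizing a b w with
  | H S ih =>
    have hs0 : 0 < s := by linarith
    have hmem := log_fieldRatio_mem hβ hγ hlam hdeg hJ hleaf hw hpar hR
    have hMw := hM _ hmem
    have hχ := hΨ.deriv_pos
    -- The fixed-point equation that closes the induction.
    have hC : (1 - κ)⁻¹ = 1 + κ * (1 - κ)⁻¹ := by
      have : (1 - κ) ≠ 0 := by linarith
      field_simp
      ring
    have hC0 : 0 < (1 - κ)⁻¹ := inv_pos.2 (by linarith)
    obtain ⟨p, q, hpq, hrec, hT⟩ := exists_children G hβ hγ hlam hx hw a b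
    set N := G.neighborFinset w ∩ S with hN
    set r : V → ℝ := fun i => fieldRatio G β γ lam (S.erase i) (p i) (q i) i with hr
    set T : V → ℝ := fun i => totalInfluence G β γ lam x (S.erase i) (p i) (q i) i with hTi
    have hT0 : ∀ i, 0 ≤ T i := fun i => totalInfluence_nonneg G hx _ _ _ _
    have hr0 : ∀ i, 0 ≤ r i := fun i => fieldRatio_nonneg G hβ hγ hlam _ _ _ i
    set χ := deriv Ψ (Real.log (fieldRatio G β γ lam S a b w)) with hχw
    have hχ0 : 0 < χ := hχ _
    -- The cut-off discards ratio `0`, where the induction hypothesis is unavailable; nothing is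
    -- lost, as `h` vanishes there.
    set m : V → ℝ := fun i => if 0 < r i then deriv Ψ (Real.log (r i)) * T i else 0 with hm
    have hm0 : ∀ i, 0 ≤ m i := fun i => by
      simp only [hm]
      split_ifs
      · exact mul_nonneg (hχ _).le (hT0 i)
      · exact le_rfl
    have hmle : ∀ i ∈ N, m i ≤ (1 - κ)⁻¹ * M * x i := fun i hi => by
      simp only [hm]
      split_ifs with h
      · obtain ⟨hc, hp⟩ := hcount.child hw hi (hpq i hi)
        exact ih _ (Finset.erase_ssubset (Finset.mem_inter.1 hi).2) _ _ i
          (Finset.notMem_erase i S) hc hp h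
      · have := hx i
        positivity
    have hterm : ∀ i ∈ N, |ratioDeriv β γ (r i)| * T i =
        |ratioDeriv β γ (r i)| / deriv Ψ (Real.log (r i)) * m i := fun i _ => by
      simp only [hm]
      split_ifs with h
      · have := (hχ (Real.log (r i))).ne'
        field_simp
      · have : r i = 0 := le_antisymm (not_lt.1 h) (hr0 i)
        rw [this, ratioDeriv_zero]
        simp
    have hcontr : χ * ∑ i ∈ N, |ratioDeriv β γ (r i)| / deriv Ψ (Real.log (r i)) * m i ≤
        δ ^ (1 / s) * (∑ i ∈ N, m i ^ s) ^ (1 / s) := by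
      -- Contraction is assumed only for `d ≥ 1`, so a leaf is treated apart; otherwise the parent
      -- gives `d < Δ`.
      rcases Nat.eq_zero_or_pos (a w + b w + N.card) with h0 | h0
      · have : N = ∅ := Finset.card_eq_zero.1 (by omega)
        rw [this]
        simp only [Finset.sum_empty, mul_zero]
        positivity
      · have hd := hdeg w
        rw [HasParent, ← hN] at hpar
        rw [hrec] at hR
        rw [hχw, hrec]
        exact hΨ.contraction_ratio hβ hγ hlam hs hδ N h0 (by omega) hr0 hm0 hR
    have hCM : 0 ≤ (1 - κ)⁻¹ * M := by positivity
    have hsum : (∑ i ∈ N, m i ^ s) ^ (1 / s) ≤ (1 - κ)⁻¹ * M * (ϱ ^ (1 / s) * x w) := by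
      have h1 : ∑ i ∈ N, m i ^ s ≤ ((1 - κ)⁻¹ * M) ^ s * (ϱ * x w ^ s) := by
        calc ∑ i ∈ N, m i ^ s ≤ ∑ i ∈ N, ((1 - κ)⁻¹ * M) ^ s * x i ^ s :=
              Finset.sum_le_sum fun i hi => by
                rw [← Real.mul_rpow hCM (hx i)]
                exact Real.rpow_le_rpow (hm0 i) (hmle i hi) hs0.le
          _ = ((1 - κ)⁻¹ * M) ^ s * ∑ i ∈ N, x i ^ s := by rw [Finset.mul_sum]
          _ ≤ _ := by
              gcongr
              exact (Finset.sum_le_sum_of_subset_of_nonneg Finset.inter_subset_left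
                fun i _ _ => Real.rpow_nonneg (hx i) s).trans (hperron w)
      have h2 := Real.rpow_le_rpow (Finset.sum_nonneg fun i _ => Real.rpow_nonneg (hm0 i) s) h1
        (by positivity : 0 ≤ 1 / s)
      have hxs : 0 ≤ x w ^ s := Real.rpow_nonneg (hx w) s
      rwa [Real.mul_rpow (by positivity) (by positivity), Real.mul_rpow hϱ hxs,
        ← Real.rpow_mul hCM, ← Real.rpow_mul (hx w), mul_one_div_cancel hs0.ne', Real.rpow_one,
        Real.rpow_one] at h2
    have hxw := hx w
    calc χ * totalInfluence G β γ lam x S a b w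
        ≤ χ * (x w + ∑ i ∈ N, |ratioDeriv β γ (r i)| * T i) :=
          mul_le_mul_of_nonneg_left hT hχ0.le
      _ = χ * x w + χ * ∑ i ∈ N, |ratioDeriv β γ (r i)| / deriv Ψ (Real.log (r i)) * m i := by
          rw [mul_add, Finset.sum_congr rfl hterm]
      _ ≤ M * x w + δ ^ (1 / s) * ((1 - κ)⁻¹ * M * (ϱ ^ (1 / s) * x w)) := by
          refine add_le_add (mul_le_mul_of_nonneg_right hMw hxw) (hcontr.trans ?_)
          gcongr
      _ = M * x w + (δ * ϱ) ^ (1 / s) * ((1 - κ)⁻¹ * M * x w) := by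
          rw [Real.mul_rpow hδ hϱ]
          ring
      _ ≤ M * x w + κ * ((1 - κ)⁻¹ * M * x w) := by gcongr
      _ = (1 - κ)⁻¹ * M * x w := by
          nth_rewrite 2 [hC]
          ring

/-- The total influence of a vertex all of whose neighbours are recorded. -/
theorem totalInfluence_le (hβ : 0 ≤ β) (hγ : 0 < γ) (hlam : 0 < lam) (hs : 1 ≤ s)
    (hδ : 0 ≤ δ) (hc : 0 ≤ c) (hΨ : IsPotential s δ c Δ β γ lam Ψ)
    (hdeg : ∀ v, G.degree v ≤ Δ) (hJ : logRatioRange β γ lam Δ ⊆ J)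
    (hleaf : ∀ v, G.degree v = 1 → Real.log lam ∈ J) (hbdd : BoundedOn β γ c Ψ J)
    (hϱ : 0 ≤ ϱ) (hx : ∀ v, 0 ≤ x v)
    (hperron : ∀ v, ∑ u ∈ G.neighborFinset v, x u ^ s ≤ ϱ * x v ^ s)
    (hκ : (δ * ϱ) ^ (1 / s) ≤ κ) (hκ1 : κ < 1) {S : Finset V} {a b : V → ℕ} {w : V}
    (hw : w ∉ S) (hcount : CountsBoundary G S a b w) :
    totalInfluence G β γ lam x S a b w ≤
      (1 + c * (1 - κ)⁻¹ * ((Δ : ℝ) ^ (1 - 1 / s) * ϱ ^ (1 / s))) * x w := by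
  have hs0 : 0 < s := by linarith
  have hC0 : 0 < (1 - κ)⁻¹ := inv_pos.2 (by linarith)
  obtain ⟨p, q, hpq, -, hT⟩ := exists_children G hβ hγ hlam hx hw a b
  set N := G.neighborFinset w ∩ S with hN
  have hterm : ∀ i ∈ N, |ratioDeriv β γ (fieldRatio G β γ lam (S.erase i) (p i) (q i) i)| *
      totalInfluence G β γ lam x (S.erase i) (p i) (q i) i ≤ c * (1 - κ)⁻¹ * x i := by
    intro i hi
    have hxi := hx i
    obtain ⟨hcnt, hpar⟩ := hcount.child hw hi (hpq i hi)
    set r := fieldRatio G β γ lam (S.erase i) (p i) (q i) i with hr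
    by_cases h0 : ratioDeriv β γ r = 0
    · rw [h0, abs_zero, zero_mul]
      positivity
    · have hr0 : 0 < r := lt_of_le_of_ne (fieldRatio_nonneg G hβ hγ hlam _ _ _ i) fun h => h0 <| by
        rw [← h, ratioDeriv_zero]
      have hh : 0 < |ratioDeriv β γ r| := abs_pos.2 h0
      have hmem := log_fieldRatio_mem hβ hγ hlam hdeg hJ hleaf (Finset.notMem_erase i S) hpar hr0
      have hχ := hΨ.deriv_pos (Real.log r)
      -- This `M`, chosen separately for each child, bounds `deriv Ψ` on `J` by boundedness with `x
      -- = log r` fixed. The factor `deriv Ψ (log r)` then cancels from both sides.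
      have := deriv_mul_totalInfluence_le hβ hγ hlam hs hδ hΨ hdeg hJ hleaf
        (M := c * deriv Ψ (Real.log r) / |ratioDeriv β γ r|) (fun z hz => by
          have hb := hbdd z hz _ hmem
          rw [recursionDeriv_log hr0, ← mul_div_assoc, div_le_iff₀ hχ] at hb
          rwa [le_div_iff₀ hh]) (by positivity) hϱ hx hperron hκ hκ1 _ _ _ i
          (Finset.notMem_erase i S) hcnt hpar hr0
      have h2 : (1 - κ)⁻¹ * (c * deriv Ψ (Real.log r) / |ratioDeriv β γ r|) * x i =
          deriv Ψ (Real.log r) * (c * (1 - κ)⁻¹ * x i / |ratioDeriv β γ r|) := by ring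
      rw [h2] at this
      have h3 := le_of_mul_le_mul_left this hχ
      rw [le_div_iff₀ hh] at h3
      linarith
  have hsum : ∑ i ∈ N, x i ≤ (Δ : ℝ) ^ (1 - 1 / s) * ϱ ^ (1 / s) * x w := by
    have hxs : 0 ≤ x w ^ s := Real.rpow_nonneg (hx w) s
    have h1 : ∑ i ∈ N, x i ≤ ∑ i ∈ G.neighborFinset w, x i :=
      Finset.sum_le_sum_of_subset_of_nonneg Finset.inter_subset_left fun i _ _ => hx i
    -- The power mean inequality over at most `Δ` neighbours produces `Δ ^ (1 - 1 / s)`.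
    have h2 := Real.rpow_sum_le_const_mul_sum_rpow_of_nonneg (G.neighborFinset w) hs
      (f := x) fun i _ => hx i
    have hd : ((G.neighborFinset w).card : ℝ) ≤ Δ := by exact_mod_cast hdeg w
    have h3 : (∑ i ∈ G.neighborFinset w, x i) ^ s ≤ (Δ : ℝ) ^ (s - 1) * (ϱ * x w ^ s) := by
      refine h2.trans ?_
      have : 0 ≤ s - 1 := by linarith
      have hnn : 0 ≤ ∑ i ∈ G.neighborFinset w, x i ^ s :=
        Finset.sum_nonneg fun i _ => Real.rpow_nonneg (hx i) s
      have := hperron w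
      gcongr
    have hnn : 0 ≤ ∑ i ∈ G.neighborFinset w, x i := Finset.sum_nonneg fun i _ => hx i
    have h4 := Real.rpow_le_rpow (Real.rpow_nonneg hnn s) h3 (by positivity : 0 ≤ 1 / s)
    rw [Real.mul_rpow (by positivity) (by positivity), Real.mul_rpow hϱ hxs,
      ← Real.rpow_mul hnn, ← Real.rpow_mul (hx w), ← Real.rpow_mul (by positivity),
      mul_one_div_cancel hs0.ne', Real.rpow_one, Real.rpow_one,
      show (s - 1) * (1 / s) = 1 - 1 / s by field_simp] at h4
    linarith
  calc totalInfluence G β γ lam x S a b w ≤ x w + ∑ i ∈ N, c * (1 - κ)⁻¹ * x i :=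
        hT.trans (add_le_add le_rfl (Finset.sum_le_sum hterm))
    _ = x w + c * (1 - κ)⁻¹ * ∑ i ∈ N, x i := by rw [Finset.mul_sum]
    _ ≤ x w + c * (1 - κ)⁻¹ * ((Δ : ℝ) ^ (1 - 1 / s) * ϱ ^ (1 / s) * x w) := by gcongr
    _ = _ := by ring

end Decay

/-! ### A Perron vector and the weighted row-sum bound -/

section Perron

variable {V : Type*} [Fintype V] [DecidableEq V]

/-- A connected graph has a positive vector `f` with `A f ≤ ‖A‖ f`. -/
theorem exists_pos_adjMatrix_le (G : SimpleGraph V) [DecidableRel G.Adj] (hconn : G.Connected) :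
    ∃ f : V → ℝ, (∀ v, 0 < f v) ∧ ∀ v, ∑ u ∈ G.neighborFinset v, f u ≤
      ‖Matrix.toEuclideanCLM (n := V) (𝕜 := ℝ) (G.adjMatrix ℝ)‖ * f v := by
  set T := Matrix.toEuclideanCLM (n := V) (𝕜 := ℝ) (G.adjMatrix ℝ) with hT
  have hsa : IsSelfAdjoint T := by
    have hA : IsSelfAdjoint (G.adjMatrix ℝ) := by
      rw [IsSelfAdjoint, Matrix.star_eq_conjTranspose, Matrix.conjTranspose_eq_transpose_of_trivial,
        SimpleGraph.transpose_adjMatrix]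
    exact hA.map (Matrix.toEuclideanCLM (n := V) (𝕜 := ℝ))
  have happ : ∀ x : EuclideanSpace ℝ V, T.reApplyInnerSelf x =
      ∑ v, x v * ∑ u ∈ G.neighborFinset v, x u := fun x => by
    rw [ContinuousLinearMap.reApplyInnerSelf_apply, real_inner_comm, hT,
      Matrix.inner_toEuclideanCLM]
    simp [dotProduct, SimpleGraph.adjMatrix_mulVec_apply]
  have : Nonempty V := hconn.nonempty
  obtain ⟨x₀, hx₀, hmax⟩ := (isCompact_sphere (0 : EuclideanSpace ℝ V) 1).exists_isMaxOn
    (NormedSpace.sphere_nonempty.2 zero_le_one) T.reApplyInnerSelf_continuous.continuousOn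
  -- Absolute values do not decrease the quadratic form, so `x₁` is also a maximiser on the sphere
  -- and hence an eigenvector.
  set x₁ : EuclideanSpace ℝ V := WithLp.toLp 2 fun v => |x₀ v| with hx₁
  have hnorm : ‖x₁‖ = 1 := by
    rw [← mem_sphere_zero_iff_norm.1 hx₀, EuclideanSpace.norm_eq, EuclideanSpace.norm_eq]
    simp [hx₁]
  have hle : T.reApplyInnerSelf x₀ ≤ T.reApplyInnerSelf x₁ := by
    rw [happ, happ]
    refine Finset.sum_le_sum fun v _ => ?_
    calc x₀ v * ∑ u ∈ G.neighborFinset v, x₀ u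
        ≤ |x₀ v| * |∑ u ∈ G.neighborFinset v, x₀ u| := by
          rw [← abs_mul]; exact le_abs_self _
      _ ≤ |x₀ v| * ∑ u ∈ G.neighborFinset v, |x₀ u| :=
          mul_le_mul_of_nonneg_left (Finset.abs_sum_le_sum_abs _ _) (abs_nonneg _)
  have hmax₁ : IsMaxOn T.reApplyInnerSelf (Metric.sphere 0 ‖x₁‖) x₁ := by
    rw [hnorm]
    exact fun y hy => (hmax hy).trans hle
  have heig := hsa.eq_smul_self_of_isLocalExtrOn_real (Or.inr hmax₁.localize)
  have hcoord : ∀ v, ∑ u ∈ G.neighborFinset v, |x₀ u| = T.rayleighQuotient x₁ * |x₀ v| :=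
    fun v => by
      have := congrArg (fun y : EuclideanSpace ℝ V => y v) heig
      simpa [hT, hx₁, Matrix.toEuclideanCLM_toLp, SimpleGraph.adjMatrix_mulVec_apply] using this
  -- A zero coordinate forces a vanishing sum of absolute values over the neighbours, so zeros
  -- spread along edges and connectedness gives positivity.
  have hzero : ∀ v u, G.Adj v u → x₀ v = 0 → x₀ u = 0 := fun v u hvu hv => by
    have h := hcoord v
    rw [hv, abs_zero, mul_zero, Finset.sum_eq_zero_iff_of_nonneg fun _ _ => abs_nonneg _] at h
    simpa using h u (by simpa using hvu)
  refine ⟨fun v => |x₀ v|, fun v => ?_, fun v => ?_⟩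
  · refine abs_pos.2 fun hv => ?_
    have hall : ∀ u, x₀ u = 0 := fun u => by
      obtain ⟨p⟩ := hconn.preconnected v u
      induction p with
      | nil => exact hv
      | cons h _ ih => exact ih (hzero _ _ h hv)
    have : x₀ = 0 := by
      ext u
      simpa using hall u
    rw [this] at hx₀
    simp at hx₀
  · rw [hcoord v]
    gcongr
    exact (le_abs_self _).trans (T.rayleighQuotient_le_norm x₁)

theorem spectralRadius_map_ofReal_le {n : Type*} [Fintype n] [DecidableEq n] {A : Matrix n n ℝ}
    {x : n → ℝ} {B : ℝ} (hx : ∀ i, 0 < x i) (h : ∀ i, ∑ j, |A i j| * x j ≤ B * x i) :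
    spectralRadius ℂ (A.map Complex.ofReal) ≤ ENNReal.ofReal B := by
  refine iSup₂_le fun k hk => ?_
  rw [← Matrix.spectrum_toLin', ← Module.End.hasEigenvalue_iff_mem_spectrum] at hk
  obtain ⟨v, hv⟩ := hk.exists_hasEigenvector
  have hv0 : v ≠ 0 := hv.2
  obtain ⟨i₁, hi₁⟩ := Function.ne_iff.1 hv0
  have : Nonempty n := ⟨i₁⟩
  -- The eigenvalue equation is read at a coordinate attaining the weighted sup norm of the
  -- eigenvector.
  obtain ⟨i, -, hi⟩ := Finset.exists_max_image Finset.univ (fun j => ‖v j‖ / x j)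
    Finset.univ_nonempty
  have hpos : 0 < ‖v i‖ / x i :=
    lt_of_lt_of_le (div_pos (norm_pos_iff.2 hi₁) (hx i₁)) (hi i₁ (Finset.mem_univ _))
  have hvi : 0 < ‖v i‖ := (div_pos_iff_of_pos_right (hx i)).1 hpos
  have heq := congrFun hv.apply_eq_smul i
  have hmain : ‖k‖ * ‖v i‖ ≤ B * ‖v i‖ := by
    calc ‖k‖ * ‖v i‖ = ‖∑ j, (A i j : ℂ) * v j‖ := by
          rw [← norm_mul, ← smul_eq_mul, ← Pi.smul_apply, ← heq]
          simp [Matrix.mulVec, dotProduct]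
      _ ≤ ∑ j, |A i j| * (‖v i‖ / x i * x j) := by
          refine (norm_sum_le _ _).trans (Finset.sum_le_sum fun j _ => ?_)
          rw [norm_mul, Complex.norm_real, Real.norm_eq_abs]
          gcongr
          exact (div_le_iff₀ (hx j)).1 (hi j (Finset.mem_univ _))
      _ = ‖v i‖ / x i * ∑ j, |A i j| * x j := by
          rw [Finset.mul_sum]
          exact Finset.sum_congr rfl fun j _ => by ring
      _ ≤ ‖v i‖ / x i * (B * x i) := by
          gcongr
          exact h i
      _ = B * ‖v i‖ := by
          have := (hx i).ne'
          field_simp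
  have hkB : ‖k‖ ≤ B := le_of_mul_le_mul_right hmain hvi
  calc (‖k‖₊ : ENNReal) = ENNReal.ofReal ‖k‖ := (ofReal_norm k).symm
    _ ≤ ENNReal.ofReal B := ENNReal.ofReal_le_ofReal hkB

end Perron

/-! ### From the Gibbs measure under a pinning to systems with boundary counts -/

section Pinning

variable {V : Type*} [Fintype V] [DecidableEq V] (G : SimpleGraph V) [DecidableRel G.Adj]
  (β γ lam : ℝ)

/-- The configuration with set of `+1` spins `T`. -/
def config (T : Finset V) : V → Bool := fun v => decide (v ∈ T)

/-- Configurations correspond to their sets of `+1` spins. -/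
def configEquiv : Finset V ≃ (V → Bool) where
  toFun := config
  invFun σ := Finset.univ.filter fun v => σ v = true
  left_inv T := by ext v; simp [config]
  right_inv σ := by ext v; simp [config]

omit [DecidableRel G.Adj] in
theorem weight_config (T : Finset V) :
    weight G β γ lam (config T) = fieldWeight G β γ lam Finset.univ 0 0 T := by
  classical
  have h1 : (Finset.univ.filter fun v : V => config T v = true) = T := by
    ext v; simp [config]
  unfold weight fieldWeight internalEdges
  simp only [Pi.zero_apply, pow_zero, mul_one, Finset.prod_const]
  congr! 3
  · simp [config]
  · simp [config]
  · simp [config]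

omit [DecidableRel G.Adj] in
theorem gibbsProb_eq (B : Set (V → Bool)) [DecidablePred (· ∈ B)] :
    gibbsProb G β γ lam B = (partitionFunction G β γ lam)⁻¹ *
      ∑ T : Finset V, fieldWeight G β γ lam Finset.univ 0 0 T *
        (if config T ∈ B then 1 else 0) := by
  rw [gibbsProb, Finset.mul_sum]
  symm
  refine Finset.sum_bijective configEquiv configEquiv.bijective (by simp) fun T _ => ?_
  by_cases h : config T ∈ B
  · simp [configEquiv, h, gibbs, weight_config, div_eq_inv_mul]
  · simp [configEquiv, h]

/-- Pinning the vertices of `Λ` one by one moves their edges into the counts and their own weights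
into `C`, which may be `0` if `β = 0`. -/
theorem exists_pinned (P Λ : Finset V) :
    ∃ (C : ℝ) (a b : V → ℕ),
      (∀ u ∈ Λᶜ, a u + b u + (G.neighborFinset u ∩ Λᶜ).card = G.degree u) ∧
      ∀ f : Finset V → ℝ, ∑ T : Finset V, fieldWeight G β γ lam Finset.univ 0 0 T *
          (if ∀ v ∈ Λ, (v ∈ T ↔ v ∈ P) then f T else 0) =
        C * ∑ T ∈ Λᶜ.powerset, fieldWeight G β γ lam Λᶜ a b T * f (T ∪ P ∩ Λ) := by
  induction Λ using Finset.induction_on with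
  | empty => exact ⟨1, 0, 0, by simp, by simp⟩
  | insert w Λ hw ih =>
    obtain ⟨C, a, b, hab, hsum⟩ := ih
    set S := (insert w Λ)ᶜ with hS
    have hwS : w ∉ S := by simp [hS]
    have hΛ : Λᶜ = insert w S := by
      ext v
      by_cases h : v = w
      · subst h; simp [hw]
      · simp [hS, h]
    rw [hΛ] at hab hsum
    have hsplit : ∀ f : Finset V → ℝ, ∑ T : Finset V, fieldWeight G β γ lam Finset.univ 0 0 T *
          (if ∀ v ∈ insert w Λ, (v ∈ T ↔ v ∈ P) then f T else 0) =
        C * (lam * β ^ a w * ∑ T ∈ S.powerset,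
          fieldWeight G β γ lam S (a + ind (G.neighborFinset w)) b T *
            (if w ∈ P then f (insert w T ∪ P ∩ Λ) else 0) +
        γ ^ b w * ∑ T ∈ S.powerset,
          fieldWeight G β γ lam S a (b + ind (G.neighborFinset w)) T *
            (if w ∉ P then f (T ∪ P ∩ Λ) else 0)) := fun f => by
      have := hsum fun T => if w ∈ T ↔ w ∈ P then f T else 0
      rw [sum_fieldWeight_insert G β γ lam hwS] at this
      have e0 : ∀ T : Finset V, (if ∀ v ∈ insert w Λ, (v ∈ T ↔ v ∈ P) then f T else 0) =
          if ∀ v ∈ Λ, (v ∈ T ↔ v ∈ P) then (if w ∈ T ↔ w ∈ P then f T else 0) else 0 :=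
        fun T => by
          rw [← ite_and]
          congr 1
          rw [Finset.forall_mem_insert, and_comm]
      simp only [e0]
      rw [this]
      congr 2
      · congr 1
        exact Finset.sum_congr rfl fun T _ => by simp
      · congr 1
        refine Finset.sum_congr rfl fun T hT => ?_
        have hwT : w ∉ T := fun h => hwS (Finset.mem_powerset.1 hT h)
        simp [hwT, hw]
    by_cases hwP : w ∈ P
    · refine ⟨C * (lam * β ^ a w), a + ind (G.neighborFinset w), b, fun u hu => ?_, fun f => ?_⟩
      · have := hab u (Finset.mem_insert_of_mem hu)
        rw [card_inter_insert _ hwS] at this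
        have h2 : ind (G.neighborFinset w) u = ind (G.neighborFinset u) w := by
          simp [ind, G.adj_comm]
        rw [Pi.add_apply]
        omega
      · rw [hsplit]
        simp only [hwP, if_true, not_true_eq_false, if_false, mul_zero, Finset.sum_const_zero,
          add_zero, Finset.inter_insert_of_mem, Finset.insert_union, Finset.union_insert]
        ring
    · refine ⟨C * γ ^ b w, a, b + ind (G.neighborFinset w), fun u hu => ?_, fun f => ?_⟩
      · have := hab u (Finset.mem_insert_of_mem hu)
        rw [card_inter_insert _ hwS] at this
        have h2 : ind (G.neighborFinset w) u = ind (G.neighborFinset u) w := by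
          simp [ind, G.adj_comm]
        rw [Pi.add_apply]
        omega
      · rw [hsplit]
        simp only [hwP, if_true, not_false_eq_true, if_false, mul_zero, Finset.sum_const_zero,
          zero_add, Finset.inter_insert_of_notMem]
        ring

/-- The rows of the influence matrix are dominated by influences in the system outside `Λ`. -/
theorem exists_influenceMatrix_le (Λ : Finset V) (τ : {v // v ∈ Λ} → Bool) :
    ∃ a b : V → ℕ, (∀ u ∈ Λᶜ, a u + b u + (G.neighborFinset u ∩ Λᶜ).card = G.degree u) ∧
      ∀ w u : {v // v ∉ Λ}, |influenceMatrix G β γ lam Λ τ w u| ≤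
        |fieldInfluence G β γ lam (Λᶜ.erase w.1) a b w.1 u.1| := by
  classical
  set P : Finset V := Finset.univ.filter fun v => ∃ h : v ∈ Λ, τ ⟨v, h⟩ = true with hP
  obtain ⟨C, a, b, hab, hsum⟩ := exists_pinned G β γ lam P Λ
  have hpin : ∀ T : Finset V, config T ∈ pinEvent Λ τ ↔ ∀ v ∈ Λ, (v ∈ T ↔ v ∈ P) := by
    intro T
    constructor
    · intro h v hv
      have h1 : config T v = τ ⟨v, hv⟩ := h ⟨v, hv⟩
      simp [hP, hv, ← h1, config]
    · rintro h ⟨v, hv⟩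
      have h1 := h v hv
      simp only [hP, Finset.mem_filter, Finset.mem_univ, true_and, hv, exists_true_left] at h1
      change decide (v ∈ T) = τ ⟨v, hv⟩
      cases h2 : τ ⟨v, hv⟩ <;> simp [h1, h2]
  set D := (partitionFunction G β γ lam)⁻¹ * C with hD
  have hprob : ∀ B : Set (V → Bool), gibbsProb G β γ lam (pinEvent Λ τ ∩ B) =
      D * ∑ T ∈ Λᶜ.powerset, fieldWeight G β γ lam Λᶜ a b T *
        (if config (T ∪ P ∩ Λ) ∈ B then 1 else 0) := fun B => by
    rw [gibbsProb_eq, hD, mul_assoc,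
      ← hsum fun T => if config T ∈ B then 1 else 0]
    congr 1
    refine Finset.sum_congr rfl fun T _ => ?_
    congr 1
    simp only [Set.mem_inter_iff, hpin, ite_and]
  refine ⟨a, b, hab, fun w u => ?_⟩
  simp only [influenceMatrix, Matrix.of_apply]
  split_ifs with hfree
  swap
  · rw [abs_zero]; exact abs_nonneg _
  have hw := w.2
  have hu := u.2
  set S := Λᶜ.erase w.1 with hS
  have hwS : w.1 ∉ S := Finset.notMem_erase _ _
  have hΛ : Λᶜ = insert w.1 S := (Finset.insert_erase (by simpa using hw)).symm
  rw [hΛ] at hprob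
  have hprob' : ∀ B : Set (V → Bool), gibbsProb G β γ lam (pinEvent Λ τ ∩ B) =
      D * (lam * β ^ a w.1 * ∑ T ∈ S.powerset,
        fieldWeight G β γ lam S (a + ind (G.neighborFinset w.1)) b T *
          (if config (insert w.1 T ∪ P ∩ Λ) ∈ B then 1 else 0) +
      γ ^ b w.1 * ∑ T ∈ S.powerset,
        fieldWeight G β γ lam S a (b + ind (G.neighborFinset w.1)) T *
          (if config (T ∪ P ∩ Λ) ∈ B then 1 else 0)) := fun B => by
    rw [hprob, sum_fieldWeight_insert G β γ lam hwS]
  have hnot : ∀ T ∈ S.powerset, w.1 ∉ T := fun T hT h => hwS (Finset.mem_powerset.1 hT h)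
  have ht : gibbsProb G β γ lam (pinEvent Λ τ ∩ spinEvent w.1 true) =
      D * (lam * β ^ a w.1) * fieldZ G β γ lam S (a + ind (G.neighborFinset w.1)) b := by
    rw [hprob', fieldZ, Finset.sum_eq_zero (f := fun T => fieldWeight G β γ lam S a _ T * _)
      fun T hT => by simp [spinEvent, config, hnot T hT, hw]]
    simp [spinEvent, config, mul_assoc]
  have hf : gibbsProb G β γ lam (pinEvent Λ τ ∩ spinEvent w.1 false) =
      D * γ ^ b w.1 * fieldZ G β γ lam S a (b + ind (G.neighborFinset w.1)) := by
    rw [hprob', fieldZ, Finset.sum_eq_zero (f := fun T => fieldWeight G β γ lam S _ b T * _)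
      fun T hT => by simp [spinEvent, config]]
    rw [mul_zero, zero_add, ← mul_assoc]
    congr 1
    exact Finset.sum_congr rfl fun T hT => by simp [spinEvent, config, hnot T hT, hw]
  have ht0 := hfree.1 true
  have hf0 := hfree.1 false
  apply le_of_eq
  congr 1
  by_cases huw : u.1 = w.1
  · rw [fieldInfluence, if_pos huw, condMarginal, condMarginal, huw, Set.inter_assoc,
      Set.inter_self, div_self ht0.ne', Set.inter_assoc,
      show spinEvent w.1 false ∩ spinEvent w.1 true = (∅ : Set (V → Bool)) by
        ext σ; simp +contextual [spinEvent]]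
    simp [gibbsProb]
  · have htu : gibbsProb G β γ lam (pinEvent Λ τ ∩ spinEvent w.1 true ∩ spinEvent u.1 true) =
        D * (lam * β ^ a w.1) *
          fieldZAt G β γ lam S (a + ind (G.neighborFinset w.1)) b u.1 := by
      rw [Set.inter_assoc, hprob', fieldZAt,
        Finset.sum_eq_zero (f := fun T => fieldWeight G β γ lam S a _ T * _)
        fun T hT => by simp [spinEvent, config, hnot T hT, hw]]
      simp [spinEvent, config, mul_assoc, huw, hu]
    have hfu : gibbsProb G β γ lam (pinEvent Λ τ ∩ spinEvent w.1 false ∩ spinEvent u.1 true) =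
        D * γ ^ b w.1 * fieldZAt G β γ lam S a (b + ind (G.neighborFinset w.1)) u.1 := by
      rw [Set.inter_assoc, hprob', fieldZAt,
        Finset.sum_eq_zero (f := fun T => fieldWeight G β γ lam S _ b T * _)
        fun T hT => by simp [spinEvent, config]]
      rw [mul_zero, zero_add, ← mul_assoc]
      congr 1
      exact Finset.sum_congr rfl fun T hT => by simp [spinEvent, config, hnot T hT, hw, hu]
    -- Both conditioning events have positive probability, so their common prefactors are nonzero
    -- and cancel.
    rw [ht] at ht0
    rw [hf] at hf0
    rw [fieldInfluence, if_neg huw, condMarginal, condMarginal, ht, hf, htu, hfu, fieldMarginal,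
      fieldMarginal, mul_div_mul_left _ _ (left_ne_zero_of_mul ht0.ne'),
      mul_div_mul_left _ _ (left_ne_zero_of_mul hf0.ne')]

end Pinning

end TwoSpin

/-! ### The spectral radius bound -/

theorem theorem11 {V : Type*} [Fintype V] [DecidableEq V]
    (G : SimpleGraph V) [DecidableRel G.Adj] (hconn : G.Connected)
    (Δ : ℕ) (hΔ : 1 < Δ) (hdeg : G.maxDegree = Δ)
    (ε ϱ s ζ β γ lam : ℝ)
    (hε : ε ∈ Set.Ioo (0 : ℝ) 1) (hϱ : 1 < ϱ) (hs : 1 ≤ s) (hζ : 0 < ζ)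
    (hβ : 0 ≤ β) (hβγ : β ≤ γ) (hγ : 0 < γ) (hlam : 0 < lam)
    (hnorm : ‖Matrix.toEuclideanCLM (n := V) (𝕜 := ℝ) (G.adjMatrix ℝ)‖ = ϱ)
    (Ψ : ℝ → ℝ)
    (hΨ : TwoSpin.IsPotential s ((1 - ε) / ϱ) (ζ / ϱ) Δ β γ lam Ψ)
    -- if there is a vertex of degree one, the log-ratio `log lam` of a leaf counts as well
    (hleaf : (∃ v, G.degree v = 1) →
      TwoSpin.BoundedOn β γ (ζ / ϱ) Ψ
        (insert (Real.log lam) (TwoSpin.logRatioRange β γ lam Δ)))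
    (Λ : Finset V) (τ : {v // v ∈ Λ} → Bool) :
    spectralRadius ℂ ((TwoSpin.influenceMatrix G β γ lam Λ τ).map Complex.ofReal) ≤
      ENNReal.ofReal
        (1 + ζ * (1 - (1 - ε) ^ (1 / s))⁻¹ * ((Δ : ℝ) / ϱ) ^ (1 - 1 / s)) := by
  obtain ⟨hε0, hε1⟩ := hε
  have hs0 : 0 < s := by linarith
  have hϱ0 : 0 < ϱ := by linarith
  have h1ε : 0 < 1 - ε := by linarith
  obtain ⟨f, hf, hfA⟩ := TwoSpin.exists_pos_adjMatrix_le G hconn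
  rw [hnorm] at hfA
  obtain ⟨J, hJ, hJleaf, hbdd⟩ : ∃ J, TwoSpin.logRatioRange β γ lam Δ ⊆ J ∧
      (∀ v, G.degree v = 1 → Real.log lam ∈ J) ∧ TwoSpin.BoundedOn β γ (ζ / ϱ) Ψ J := by
    by_cases h : ∃ v, G.degree v = 1
    · exact ⟨_, Set.subset_insert _ _, fun _ _ => Set.mem_insert _ _, hleaf h⟩
    · exact ⟨_, subset_rfl, fun v hv => absurd ⟨v, hv⟩ h, hΨ.boundedness⟩
  -- The power is chosen so that the Perron inequality bounds the sum of `x u ^ s` left by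
  -- contraction.
  set x : V → ℝ := fun v => f v ^ (1 / s) with hx
  have hx0 : ∀ v, 0 < x v := fun v => Real.rpow_pos_of_pos (hf v) _
  have hxs : ∀ v, x v ^ s = f v := fun v => by
    rw [hx, ← Real.rpow_mul (hf v).le, one_div_mul_cancel hs0.ne', Real.rpow_one]
  obtain ⟨a, b, hab, hI⟩ := TwoSpin.exists_influenceMatrix_le G β γ lam Λ τ
  -- The factor `1 / ϱ` of `c` and `ϱ ^ (1 / s)` from the Perron inequality combine to `ϱ ^ (-(1 - 1
  -- / s))`.
  have hB : ζ * (1 - (1 - ε) ^ (1 / s))⁻¹ * ((Δ : ℝ) / ϱ) ^ (1 - 1 / s) =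
      ζ / ϱ * (1 - (1 - ε) ^ (1 / s))⁻¹ * ((Δ : ℝ) ^ (1 - 1 / s) * ϱ ^ (1 / s)) := by
    rw [Real.div_rpow (by positivity) hϱ0.le, Real.rpow_sub hϱ0, Real.rpow_one]
    field_simp
  rw [hB]
  refine TwoSpin.spectralRadius_map_ofReal_le (x := fun v : {v // v ∉ Λ} => x v.1)
    (fun v => hx0 v.1) fun w => ?_
  have hins : insert w.1 (Λᶜ.erase w.1) = Λᶜ := Finset.insert_erase (by simpa using w.2)
  have hmain := TwoSpin.totalInfluence_le (G := G) (β := β) (γ := γ) (lam := lam) (s := s)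
    (δ := (1 - ε) / ϱ) (c := ζ / ϱ) (ϱ := ϱ) (κ := (1 - ε) ^ (1 / s)) (Δ := Δ) (Ψ := Ψ) (J := J)
    (x := x) hβ hγ hlam hs (by positivity) (by positivity) hΨ
    (fun v => hdeg ▸ G.degree_le_maxDegree v) hJ hJleaf hbdd hϱ0.le (fun v => (hx0 v).le)
    (fun v => by simpa only [hxs] using hfA v)
    (by rw [div_mul_cancel₀ _ hϱ0.ne'])
    (Real.rpow_lt_one h1ε.le (by linarith) (by positivity))
    (S := Λᶜ.erase w.1) (a := a) (b := b) (w := w.1) (Finset.notMem_erase _ _)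
    (fun u hu => by rw [hins]; exact hab u (Finset.mem_of_mem_erase hu))
  refine le_trans ?_ hmain
  rw [TwoSpin.totalInfluence, hins, Finset.sum_subtype Λᶜ (p := fun v => v ∉ Λ) (by simp)]
  exact Finset.sum_le_sum fun u _ => mul_le_mul_of_nonneg_right (hI w u) (hx0 u.1).le
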